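/- For $m\ge 1$ let $P_m$ denote the path with $m$ vertices. For a finite simple graph $X$ with adjacency matrix $A$ put $U(t)=\exp(-itA)$, $t\in\mathbb{R}$. There is pretty good state transfer (PGST) from a vertex $a$ to a vertex $b$ of $X$ if for every $\epsilon>0$ there is $\tau\in\mathbb{R}$ with $|U(\tau)_{b,a}|>1-\epsilon$; this is an equivalence relation on the vertices of $X$, whose classes are called PGST-equivalence classes. Let $X=P_{n_1}\square\cdots\square P_{n_k}$ be a cartesian product of $k\ge 2$ paths with all $n_i\ge 2$. A corner of $X$ is a vertex $(a_1,\dots,a_k)$ in which every $a_i$ is an end of $P_{n_i}$ (there are $2^k$ corners). Then all corners of $X$ belong to the same PGST-equivalence class if and only if, up to a permutation of the cartesian factors, one of the following holds. (1) $X=P_{2^e-1}\square P_{p-1}$ for some $e\ge 2$ and some prime $p\ge 3$. (2) $X=P_{2^e-1}\square P_{2p-1}$ for some $e\ge 2$ and some prime $p\ge 3$. (3) $X=P_{p_1-1}\square\cdots\square P_{p_h-1}\square P_{2q_1-1}\square\cdots\square P_{2q_l-1}$, where $h,l\ge 0$ and $p_1,\dots,p_h,q_1,\dots,q_l$ are distinct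 primes with $p_i\equiv 1\pmod 8$ for all $i$ and $q_j\equiv 1\pmod 4$ for all $j$. (4) $X=P_{2^e-1}\square P_{p_1-1}\square\cdots\square P_{p_h-1}\square P_{2q_1-1}\square\cdots\square P_{2q_l-1}$, where $e\ge 2$, $h,l\ge 0$ and $p_1,\dots,p_h,q_1,\dots,q_l$ are distinct primes with $p_i\equiv 1\pmod 8$ for all $i$ and $q_j\equiv 1\pmod 4$ for all $j$. In particular, PGST-equivalence classes can be arbitrarily large: for every $N$ there is a cartesian product of at least two paths, each with at least two vertices, that has a PGST-equivalence class with at least $N$ elements. -/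

import Mathlib

noncomputable section

/-- The transition matrix `U(t) = exp(-i t A)` of the continuous-time quantum walk on a finite
simple graph `G`, where `A` is the adjacency matrix of `G`. -/
def transitionMatrix {V : Type*} [Fintype V] [DecidableEq V] (G : SimpleGraph V)
    [DecidableRel G.Adj] (t : ℝ) : Matrix V V ℂ :=
  NormedSpace.exp ((-(Complex.I * (t : ℂ))) • G.adjMatrix ℂ)

/-- Pretty good state transfer from `a` to `b`. -/
def PGST {V : Type*} [Fintype V] [DecidableEq V] (G : SimpleGraph V)
    [DecidableRel G.Adj] (a b : V) : Prop :=
  ∀ ε : ℝ, 0 < ε → ∃ τ : ℝ, 1 - ε < ‖transitionMatrix G τ b a‖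

section Equivalence

variable {V : Type*} [Fintype V] [DecidableEq V] (G : SimpleGraph V) [DecidableRel G.Adj]

theorem transitionMatrix_zero : transitionMatrix G 0 = 1 := by
  simp [transitionMatrix]

theorem transitionMatrix_add (s t : ℝ) :
    transitionMatrix G (s + t) = transitionMatrix G s * transitionMatrix G t := by
  unfold transitionMatrix
  rw [← Matrix.exp_add_of_commute _ _
    (((Commute.refl (G.adjMatrix ℂ)).smul_left _).smul_right _), ← add_smul]
  congr 2
  push_cast
  ring

theorem transitionMatrix_symm (t : ℝ) (a b : V) :
    transitionMatrix G t a b = transitionMatrix G t b a := by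
  have h : (transitionMatrix G t).IsSymm :=
    Matrix.IsSymm.exp (Matrix.IsSymm.smul (SimpleGraph.isSymm_adjMatrix G) _)
  exact h.apply b a

theorem transitionMatrix_conjTranspose (t : ℝ) :
    (transitionMatrix G t).conjTranspose = transitionMatrix G (-t) := by
  unfold transitionMatrix
  rw [← Matrix.exp_conjTranspose, Matrix.conjTranspose_smul]
  congr 2
  · simp
  · ext i j
    simp [Matrix.conjTranspose_apply, SimpleGraph.adjMatrix_apply, G.adj_comm i j, apply_ite]

theorem sum_sq_norm_transitionMatrix (t : ℝ) (a : V) :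
    ∑ b, ‖transitionMatrix G t a b‖ ^ 2 = 1 := by
  have h : transitionMatrix G t * (transitionMatrix G t).conjTranspose = 1 := by
    rw [transitionMatrix_conjTranspose, ← transitionMatrix_add, add_neg_cancel,
      transitionMatrix_zero]
  have h2 := congrFun (congrFun h a) a
  rw [Matrix.mul_apply, Matrix.one_apply_eq] at h2
  have h3 : ((∑ b, ‖transitionMatrix G t a b‖ ^ 2 : ℝ) : ℂ) = 1 := by
    rw [← h2]
    push_cast
    refine Finset.sum_congr rfl fun b _ => ?_
    rw [Matrix.conjTranspose_apply]
    exact (Complex.mul_conj' _).symm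
  exact_mod_cast h3

theorem PGST.refl (a : V) : PGST G a a := by
  intro ε hε
  refine ⟨0, ?_⟩
  rw [transitionMatrix_zero, Matrix.one_apply_eq]
  simpa using hε

variable {G}

theorem PGST.symm {a b : V} (h : PGST G a b) : PGST G b a := by
  intro ε hε
  obtain ⟨τ, hτ⟩ := h ε hε
  exact ⟨τ, by rwa [transitionMatrix_symm]⟩

theorem PGST.trans {a b c : V} (hab : PGST G a b) (hbc : PGST G b c) : PGST G a c := by
  intro ε hε
  have hδ : 0 < min (ε / 4) 1 := by positivity
  have hδ1 : min (ε / 4) 1 ≤ ε / 4 := min_le_left _ _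
  have hδ2 : min (ε / 4) 1 ≤ 1 := min_le_right _ _
  set δ := min (ε / 4) 1
  obtain ⟨s, hs⟩ := hab δ hδ
  obtain ⟨t, ht⟩ := hbc δ hδ
  refine ⟨t + s, ?_⟩
  rw [transitionMatrix_add, Matrix.mul_apply]
  have hf := sum_sq_norm_transitionMatrix G s a
  have hg := sum_sq_norm_transitionMatrix G t c
  simp_rw [fun x => transitionMatrix_symm G s x a]
  rw [transitionMatrix_symm G s b a] at hs
  set f := transitionMatrix G s a
  set g := transitionMatrix G t c
  rw [← Finset.add_sum_erase _ _ (Finset.mem_univ b)] at hf hg ⊢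
  have h1 : ‖∑ x ∈ Finset.univ.erase b, g x * f x‖
      ≤ ∑ x ∈ Finset.univ.erase b, (‖g x‖ ^ 2 / 2 + ‖f x‖ ^ 2 / 2) := by
    refine (norm_sum_le _ _).trans (Finset.sum_le_sum fun x _ => ?_)
    rw [norm_mul]
    nlinarith [sq_nonneg (‖g x‖ - ‖f x‖)]
  rw [Finset.sum_add_distrib, ← Finset.sum_div, ← Finset.sum_div] at h1
  have h2 := norm_sub_le_norm_add (g b * f b) (∑ x ∈ Finset.univ.erase b, g x * f x)
  rw [norm_mul] at h2
  nlinarith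

variable (G)

/-- The equivalence relation on vertices given by pretty good state transfer; its classes
`(pgstSetoid G).classes` are the PGST-equivalence classes of `G`. -/
def pgstSetoid : Setoid V where
  r := PGST G
  iseqv := ⟨PGST.refl G, PGST.symm, PGST.trans⟩

end Equivalence

/-- The cartesian product `P_{n 0} □ ⋯ □ P_{n (k-1)}` of paths, where `P_m` is the path with `m`
vertices: two vertices are adjacent if they are adjacent in one coordinate and agree in all
others. -/
def pathProduct {k : ℕ} (n : Fin k → ℕ) : SimpleGraph ((i : Fin k) → Fin (n i)) where
  Adj x y := ∃ i, (SimpleGraph.pathGraph (n i)).Adj (x i) (y i) ∧ ∀ j, j ≠ i → x j = y j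
  symm := ⟨fun _ _ ⟨i, h, hj⟩ => ⟨i, h.symm, fun j hji => (hj j hji).symm⟩⟩
  loopless := ⟨fun _ ⟨_, h, _⟩ => h.ne rfl⟩

instance {k : ℕ} (n : Fin k → ℕ) : DecidableRel (pathProduct n).Adj :=
  Classical.decRel _

/-- The corners: vertices all of whose components are ends of the corresponding paths. -/
def corners {k : ℕ} (n : Fin k → ℕ) : Set ((i : Fin k) → Fin (n i)) :=
  {x | ∀ i, (x i : ℕ) = 0 ∨ (x i : ℕ) + 1 = n i}

end

/-! Products of sine vectors diagonalise the adjacency matrix, so U(t) factors over the paths.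
Reflecting a path multiplies its r-th eigenvector (r counted from 0) by (-1)^r. Hence the amplitude
from the origin to a corner is a product of convex combinations of phases exp(itθ), twisted by
signs, and PGST holds exactly when, in a limit of times, the twisted phases agree within every
factor. By Kronecker's theorem (`addChar_mem_closure_range_exp`) only integer relations between
eigenvalues obstruct this. All corners are equivalent iff every relation ∑ l_{i,r} θ_{i,r} = 0 with
∑_r l_{i,r} = 0 for each i has an even antisymmetric part E_i = ∑_{r odd} l_{i,r} in each factor
(`forall_pgst_corner_iff`).

Necessity comes from explicit relations; write m = n + 1. Equally spaced cosines exclude m = ps with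
p odd, p, s ≥ 3, so m is a power of 2, an odd prime p, or 2p. Shared eigenvalues exclude m_i ∣ m_j
for i ≠ j. Cosine sums equal to 1 let two odd factors trade an integer value, which forces p ≡ 1 mod
8 (for m = p) or mod 4 (for m = 2p).

For sufficiency, let V_i be the value contributed by factor i to a relation. If m_i is p or 2p,
Galois conjugations that fix the eigenvalues of all other factors show that V_i is rational, hence
an integer c, with (p - 1)c = -2S for an explicit signed sum S of the coefficients
(`prime_sub_one_mul_eigenvalue_sum`). Here S = 2E_i for m = p and S ≡ E_i mod 2 for m = 2p, so the
congruences make E_i even. If there is only one odd factor then c = 0 and no congruence is needed,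
which accounts for cases (1) and (2). In a power-of-two factor an integer value forces the
coefficients to be palindromic (`eigenvalue_relation_pow_two`), and pairing r with its reflection
makes E_i even. -/

/-! ### Spectral decomposition of a path -/

/-- The eigenvalues `2 cos (π (r + 1) / (n + 1))` of the path with `n` vertices. -/
noncomputable def pathEigenvalue (n : ℕ) (r : Fin n) : ℝ :=
  2 * Real.cos (Real.pi * (r + 1) / (n + 1))

/-- The eigenvectors of the path with `n` vertices. -/
noncomputable def sineVec (n : ℕ) (r x : Fin n) : ℝ :=
  Real.sin (Real.pi * (r + 1) / (n + 1) * (x + 1))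

instance (n : ℕ) : DecidableRel (SimpleGraph.pathGraph n).Adj :=
  fun _ _ => decidable_of_iff _ SimpleGraph.pathGraph_adj.symm

/-- The vertices are numbered from 1, and f vanishes at the phantom vertices 0 and n + 1, so the
ends obey the same recurrence as the interior. -/
theorem sum_pathGraph_adj (n : ℕ) (x : Fin n) (f : ℕ → ℝ) (h0 : f 0 = 0) (hn : f (n + 1) = 0) :
    ∑ y : Fin n, (if (SimpleGraph.pathGraph n).Adj x y then f (y + 1) else 0) =
      f x + f (x + 2) := by
  have h : ∀ y : Fin n, (if (SimpleGraph.pathGraph n).Adj x y then f (y + 1) else 0) =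
      (if (y : ℕ) + 1 = x then f (y + 1) else 0) + (if (y : ℕ) = x + 1 then f (y + 1) else 0) := by
    intro y
    simp only [SimpleGraph.pathGraph_adj]
    split_ifs <;> first | omega | simp
  simp_rw [h]
  rw [Finset.sum_add_distrib]
  congr 1
  · rcases Nat.eq_zero_or_pos (x : ℕ) with hx | hx
    · rw [hx, h0]
      exact Finset.sum_eq_zero fun y _ => if_neg (by omega)
    · rw [Finset.sum_eq_single (⟨x - 1, by omega⟩ : Fin n)]
      · simp [Nat.sub_add_cancel hx]
      · intro y _ hy
        refine if_neg fun h => hy (Fin.ext ?_)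
        simp; omega
      · simp
  · by_cases hx : (x : ℕ) + 1 = n
    · rw [show (x : ℕ) + 2 = n + 1 by omega, hn]
      exact Finset.sum_eq_zero fun y _ => if_neg (by omega)
    · rw [Finset.sum_eq_single (⟨x + 1, by omega⟩ : Fin n)]
      · simp
      · intro y _ hy
        refine if_neg fun h => hy (Fin.ext ?_)
        simp; omega
      · simp

theorem sum_adj_mul_sineVec (n : ℕ) (r x : Fin n) :
    ∑ y : Fin n, (if (SimpleGraph.pathGraph n).Adj x y then sineVec n r y else 0) =
      pathEigenvalue n r * sineVec n r x := by
  have h := sum_pathGraph_adj n x (fun z => Real.sin (Real.pi * (r + 1) / (n + 1) * z)) (by simp)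
    (by
      have : Real.pi * (r + 1) / (n + 1) * ((n + 1 : ℕ) : ℝ) = ((r + 1 : ℕ) : ℝ) * Real.pi := by
        push_cast; field_simp
      simp only [this, Real.sin_nat_mul_pi])
  simp only [sineVec, pathEigenvalue]
  push_cast at h
  rw [h]
  set c := Real.pi * (r + 1) / (n + 1)
  rw [show c * x = c * (x + 1) - c by ring, show c * (x + 2) = c * (x + 1) + c by ring,
    Real.sin_sub, Real.sin_add]
  ring

theorem pathEigenvalue_injective (n : ℕ) : Function.Injective (pathEigenvalue n) := by
  intro r s h
  have hn : (0 : ℝ) < n + 1 := by positivity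
  have key : ∀ r : Fin n, Real.pi * (r + 1) / (n + 1) ∈ Set.Icc 0 Real.pi := by
    intro r
    refine ⟨by positivity, ?_⟩
    rw [div_le_iff₀ hn]
    have : ((r : ℕ) : ℝ) + 1 ≤ n := by exact_mod_cast r.2
    nlinarith [Real.pi_pos]
  have h2 := Real.injOn_cos (key r) (key s) (by simpa [pathEigenvalue] using h)
  have h3 : ((r : ℕ) : ℝ) = s := by
    have := Real.pi_pos
    field_simp at h2
    linarith
  exact Fin.ext (by exact_mod_cast h3)

/-- The adjacency matrix is symmetric and the two eigenvalues differ: the bilinear form evaluated on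
either side gives both eigenvalues times the inner product. -/
theorem sum_sineVec_mul_sineVec (n : ℕ) {r s : Fin n} (h : r ≠ s) :
    ∑ x, sineVec n r x * sineVec n s x = 0 := by
  have h1 : ∑ x, ∑ y, (if (SimpleGraph.pathGraph n).Adj x y then
      sineVec n r x * sineVec n s y else 0) =
      pathEigenvalue n s * ∑ x, sineVec n r x * sineVec n s x := by
    rw [Finset.mul_sum]
    refine Finset.sum_congr rfl fun x _ => ?_
    rw [mul_left_comm, ← sum_adj_mul_sineVec, Finset.mul_sum]
    simp
  have h2 : ∑ x, ∑ y, (if (SimpleGraph.pathGraph n).Adj x y then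
      sineVec n r x * sineVec n s y else 0) =
      pathEigenvalue n r * ∑ x, sineVec n r x * sineVec n s x := by
    rw [Finset.sum_comm, Finset.mul_sum]
    refine Finset.sum_congr rfl fun x _ => ?_
    rw [← mul_assoc, ← sum_adj_mul_sineVec, Finset.sum_mul]
    refine Finset.sum_congr rfl fun y _ => ?_
    simp [SimpleGraph.adj_comm]
  have h3 := h1.symm.trans h2
  have h4 : pathEigenvalue n s - pathEigenvalue n r ≠ 0 :=
    sub_ne_zero.2 fun e => h (pathEigenvalue_injective n e).symm
  have h5 : (pathEigenvalue n s - pathEigenvalue n r) * ∑ x, sineVec n r x * sineVec n s x = 0 := by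
    linarith
  exact (mul_eq_zero.1 h5).resolve_left h4

theorem sineVec_zero_pos (n : ℕ) (r x : Fin n) (hx : (x : ℕ) = 0) : 0 < sineVec n r x := by
  have hn : (0 : ℝ) < n + 1 := by positivity
  rw [sineVec, hx]
  refine Real.sin_pos_of_pos_of_lt_pi (by positivity) ?_
  rw [Nat.cast_zero, zero_add, mul_one, div_lt_iff₀ hn]
  have : ((r : ℕ) : ℝ) + 1 ≤ n := by exact_mod_cast r.2
  nlinarith [Real.pi_pos]

theorem sineVec_rev (n : ℕ) (r x : Fin n) : sineVec n r x.rev = (-1) ^ (r : ℕ) * sineVec n r x := by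
  have hn : (n : ℝ) + 1 ≠ 0 := by positivity
  have h : (((x.rev : Fin n) : ℕ) : ℝ) = n - (x + 1) := by
    rw [Fin.val_rev, Nat.cast_sub (by omega)]
    push_cast; ring
  rw [sineVec, h, show Real.pi * (r + 1) / (n + 1) * ((n : ℝ) - (x + 1) + 1) =
    ((r + 1 : ℕ) : ℝ) * Real.pi - Real.pi * (r + 1) / (n + 1) * (x + 1) by
      push_cast; field_simp; ring, Real.sin_nat_mul_pi_sub, sineVec, pow_succ]
  ring

theorem sum_sineVec_sq_pos (n : ℕ) (r : Fin n) : 0 < ∑ x, sineVec n r x ^ 2 := by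
  have : 0 < n := r.pos
  refine Finset.sum_pos' (fun _ _ => sq_nonneg _) ⟨⟨0, this⟩, Finset.mem_univ _, ?_⟩
  exact pow_pos (sineVec_zero_pos n r _ rfl) 2

/-- The normalized eigenvectors of the path with `n` vertices. -/
noncomputable def unitSineVec (n : ℕ) (r x : Fin n) : ℝ :=
  sineVec n r x / Real.sqrt (∑ y, sineVec n r y ^ 2)

theorem sum_unitSineVec_mul (n : ℕ) (r s : Fin n) :
    ∑ x, unitSineVec n r x * unitSineVec n s x = if r = s then 1 else 0 := by
  simp only [unitSineVec, div_mul_div_comm, ← Finset.sum_div]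
  split_ifs with h
  · subst h
    rw [Real.mul_self_sqrt (sum_sineVec_sq_pos n r).le]
    simp only [← sq]
    exact div_self (sum_sineVec_sq_pos n r).ne'
  · rw [sum_sineVec_mul_sineVec n h, zero_div]

theorem sum_adj_mul_unitSineVec (n : ℕ) (r x : Fin n) :
    ∑ y : Fin n, (if (SimpleGraph.pathGraph n).Adj x y then unitSineVec n r y else 0) =
      pathEigenvalue n r * unitSineVec n r x := by
  have h := sum_adj_mul_sineVec n r x
  simp only [unitSineVec]
  rw [← mul_div_assoc, ← h, Finset.sum_div]
  refine Finset.sum_congr rfl fun y _ => ?_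
  split_ifs <;> simp

theorem unitSineVec_rev (n : ℕ) (r x : Fin n) :
    unitSineVec n r x.rev = (-1) ^ (r : ℕ) * unitSineVec n r x := by
  rw [unitSineVec, sineVec_rev, unitSineVec, mul_div_assoc]

theorem unitSineVec_zero_pos (n : ℕ) (r x : Fin n) (hx : (x : ℕ) = 0) : 0 < unitSineVec n r x :=
  div_pos (sineVec_zero_pos n r x hx) (Real.sqrt_pos.2 (sum_sineVec_sq_pos n r))

/-! ### Diagonalisation of a product of paths -/

section Product

variable {k : ℕ} (n : Fin k → ℕ)

/-- This is the expansion into Kronecker products I ⊗ ⋯ ⊗ A_i ⊗ ⋯ ⊗ I. At most one summand is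
nonzero, since adjacency in coordinate i forces x and y to differ there. -/
theorem adjMatrix_pathProduct_apply (x y : (i : Fin k) → Fin (n i)) :
    (pathProduct n).adjMatrix ℂ x y = ∑ i, ∏ j, (if j = i then
      (if (SimpleGraph.pathGraph (n j)).Adj (x j) (y j) then (1 : ℂ) else 0)
      else (if x j = y j then 1 else 0)) := by
  have hi : ∀ i, (∏ j, (if j = i then
      (if (SimpleGraph.pathGraph (n j)).Adj (x j) (y j) then (1 : ℂ) else 0)
      else (if x j = y j then 1 else 0))) =
      if (SimpleGraph.pathGraph (n i)).Adj (x i) (y i) ∧ ∀ j, j ≠ i → x j = y j then 1 else 0 := by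
    intro i
    split_ifs with h
    · refine Finset.prod_eq_one fun j _ => ?_
      by_cases hj : j = i
      · subst hj; simp [h.1]
      · simp [hj, h.2 j hj]
    · rw [not_and_or] at h
      rcases h with h | h
      · exact Finset.prod_eq_zero (Finset.mem_univ i) (by simp [h])
      · push Not at h
        obtain ⟨j, hj, hne⟩ := h
        exact Finset.prod_eq_zero (Finset.mem_univ j) (by simp [hj, hne])
  simp_rw [hi]
  rw [SimpleGraph.adjMatrix_apply]
  by_cases h : (pathProduct n).Adj x y
  · rw [if_pos h]
    obtain ⟨i, hi⟩ := h
    rw [Finset.sum_eq_single i, if_pos hi]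
    · intro j _ hj
      refine if_neg fun h => ?_
      exact h.1.ne (hi.2 j hj)
    · simp
  · rw [if_neg h]
    exact (Finset.sum_eq_zero fun i _ => if_neg fun hi => h ⟨i, hi⟩).symm

/-- The matrix whose columns are the normalized eigenvectors of a product of paths. -/
noncomputable def sineMatrix : Matrix ((i : Fin k) → Fin (n i)) ((i : Fin k) → Fin (n i)) ℂ :=
  Matrix.of fun x r => ∏ i, (unitSineVec (n i) (r i) (x i) : ℂ)

theorem transpose_sineMatrix_mul : (sineMatrix n).transpose * sineMatrix n = 1 := by
  ext r s
  simp only [Matrix.mul_apply, Matrix.transpose_apply, sineMatrix, Matrix.of_apply,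
    ← Finset.prod_mul_distrib]
  rw [← Fintype.prod_sum (fun i x => (unitSineVec (n i) (r i) x : ℂ) * unitSineVec (n i) (s i) x)]
  have : ∀ i, ∑ x, (unitSineVec (n i) (r i) x : ℂ) * unitSineVec (n i) (s i) x =
      if r i = s i then 1 else 0 := by
    intro i
    have := sum_unitSineVec_mul (n i) (r i) (s i)
    have h : ((if r i = s i then 1 else 0 : ℝ) : ℂ) = if r i = s i then 1 else 0 := by
      split_ifs <;> simp
    rw [← h, ← this]
    push_cast
    rfl
  simp_rw [this]
  by_cases h : r = s
  · subst h; simp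
  · rw [Matrix.one_apply_ne h]
    obtain ⟨i, hi⟩ := Function.ne_iff.1 h
    exact Finset.prod_eq_zero (Finset.mem_univ i) (if_neg hi)

theorem adjMatrix_mul_sineMatrix :
    (pathProduct n).adjMatrix ℂ * sineMatrix n =
      sineMatrix n * Matrix.diagonal fun r => ∑ i, (pathEigenvalue (n i) (r i) : ℂ) := by
  ext x r
  rw [Matrix.mul_diagonal, Matrix.mul_apply]
  simp_rw [adjMatrix_pathProduct_apply, Finset.sum_mul]
  rw [Finset.sum_comm, Finset.mul_sum]
  refine Finset.sum_congr rfl fun i _ => ?_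
  simp only [sineMatrix, Matrix.of_apply, ← Finset.prod_mul_distrib]
  rw [← Fintype.prod_sum (fun j y => (if j = i then
      (if (SimpleGraph.pathGraph (n j)).Adj (x j) y then (1 : ℂ) else 0)
      else (if x j = y then 1 else 0)) * (unitSineVec (n j) (r j) y : ℂ))]
  have : ∀ j, (∑ y, (if j = i then
      (if (SimpleGraph.pathGraph (n j)).Adj (x j) y then (1 : ℂ) else 0)
      else (if x j = y then 1 else 0)) * (unitSineVec (n j) (r j) y : ℂ)) =
      (if j = i then (pathEigenvalue (n j) (r j) : ℂ) else 1) *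
        unitSineVec (n j) (r j) (x j) := by
    intro j
    by_cases hj : j = i
    · simp only [hj, if_true]
      have := congrArg (fun x : ℝ => (x : ℂ)) (sum_adj_mul_unitSineVec (n j) (r j) (x j))
      push_cast at this
      rw [← this]
      refine Finset.sum_congr rfl fun y _ => ?_
      split_ifs <;> simp
    · simp [hj]
  simp_rw [this, Finset.prod_mul_distrib]
  simp [mul_comm]

/-- The transition amplitude `U(t)_{y,x}` of the path with `n` vertices. -/
noncomputable def pathAmplitude (n : ℕ) (t : ℝ) (y x : Fin n) : ℂ :=
  ∑ r, (unitSineVec n r y * unitSineVec n r x : ℝ) * Circle.exp (-(t * pathEigenvalue n r))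

/-- Eigenvalues of the product are sums of path eigenvalues, so their exponentials multiply and the
sum over eigenvector tuples factors. -/
theorem transitionMatrix_pathProduct (t : ℝ) (x y : (i : Fin k) → Fin (n i)) :
    transitionMatrix (pathProduct n) t y x = ∏ i, pathAmplitude (n i) t (y i) (x i) := by
  have h1 := transpose_sineMatrix_mul n
  have h2 : sineMatrix n * (sineMatrix n).transpose = 1 := mul_eq_one_comm.1 h1
  have hinv : (sineMatrix n)⁻¹ = (sineMatrix n).transpose := Matrix.inv_eq_left_inv h1
  have hunit : IsUnit (sineMatrix n) := IsUnit.of_mul_eq_one _ h2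
  set D := fun r : (i : Fin k) → Fin (n i) => ∑ i, (pathEigenvalue (n i) (r i) : ℂ)
  have hA : (-(Complex.I * (t : ℂ))) • (pathProduct n).adjMatrix ℂ =
      sineMatrix n * Matrix.diagonal ((-(Complex.I * (t : ℂ))) • D) * (sineMatrix n)⁻¹ := by
    rw [hinv, Matrix.diagonal_smul, Matrix.mul_smul, Matrix.smul_mul,
      ← adjMatrix_mul_sineMatrix, mul_assoc, h2, mul_one]
  rw [transitionMatrix, hA, Matrix.exp_conj _ _ hunit, hinv, Matrix.exp_diagonal, Matrix.mul_apply]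
  simp only [Matrix.mul_diagonal, Matrix.transpose_apply, sineMatrix, Matrix.of_apply,
    pathAmplitude]
  rw [Fintype.prod_sum]
  refine Finset.sum_congr rfl fun r _ => ?_
  have : NormedSpace.exp (-(Complex.I * (t : ℂ)) • D) r =
      ∏ i, (Circle.exp (-(t * pathEigenvalue (n i) (r i))) : ℂ) := by
    rw [Pi.coe_exp]
    simp only [Pi.smul_apply, D, ← Complex.exp_eq_exp_ℂ, Circle.coe_exp, ← Complex.exp_sum,
      smul_eq_mul, Finset.mul_sum]
    congr 1
    refine Finset.sum_congr rfl fun i _ => ?_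
    push_cast
    ring
  rw [this, ← Finset.prod_mul_distrib, ← Finset.prod_mul_distrib]
  refine Finset.prod_congr rfl fun i _ => ?_
  push_cast
  ring

end Product

/-! ### Kronecker approximation and extension of characters -/

/-- The mean of the sum against exp(-iμt) over [0, T] isolates the coefficient at μ; the integrals
of the other terms are bounded by D independently of T. -/
theorem norm_coeff_le_of_norm_sum_exp_le (Λ : Finset ℝ) (C : ℝ → ℂ) (B : ℝ)
    (h : ∀ t : ℝ, ‖∑ l ∈ Λ, C l * Circle.exp (t * l)‖ ≤ B) {μ : ℝ} (hμ : μ ∈ Λ) : ‖C μ‖ ≤ B := by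
  set D := ∑ l ∈ Λ.erase μ, ‖C l‖ * (2 / |l - μ|)
  have hD : 0 ≤ D := Finset.sum_nonneg fun l _ => by positivity
  have key : ∀ T : ℝ, 0 < T → T * ‖C μ‖ ≤ T * B + D := by
    intro T hT
    have h1 : ‖∫ t in (0 : ℝ)..T, ∑ l ∈ Λ, C l * Complex.exp (Complex.I * (l - μ) * t)‖
        ≤ B * |T - 0| := by
      refine intervalIntegral.norm_integral_le_of_norm_le_const fun t _ => ?_
      have h2 : ∑ l ∈ Λ, C l * Complex.exp (Complex.I * (l - μ) * t) =
          (∑ l ∈ Λ, C l * Circle.exp (t * l)) * Circle.exp (-(t * μ)) := by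
        rw [Finset.sum_mul]
        refine Finset.sum_congr rfl fun l _ => ?_
        rw [Circle.coe_exp, Circle.coe_exp, mul_assoc (C l) (Complex.exp _), ← Complex.exp_add]
        congr 2
        push_cast
        ring
      rw [h2, norm_mul, Circle.norm_coe, mul_one]
      exact h t
    rw [intervalIntegral.integral_finsetSum
      (fun l _ => Continuous.intervalIntegrable (by fun_prop) _ _)] at h1
    simp only [intervalIntegral.integral_const_mul] at h1
    rw [← Finset.add_sum_erase _ _ hμ] at h1
    have h3 : (∫ t in (0 : ℝ)..T, Complex.exp (Complex.I * (μ - μ) * t)) = T := by simp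
    rw [h3] at h1
    have h4 : ‖∑ l ∈ Λ.erase μ, C l * ∫ t in (0 : ℝ)..T, Complex.exp (Complex.I * (l - μ) * t)‖
        ≤ D := by
      refine (norm_sum_le _ _).trans (Finset.sum_le_sum fun l hl => ?_)
      rw [norm_mul]
      refine mul_le_mul_of_nonneg_left ?_ (norm_nonneg _)
      have hne : (l : ℂ) - μ ≠ 0 := by
        rw [sub_ne_zero]
        exact_mod_cast Finset.ne_of_mem_erase hl
      rw [integral_exp_mul_complex (mul_ne_zero Complex.I_ne_zero hne), norm_div, norm_mul,
        Complex.norm_I, one_mul]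
      have h5 : ‖(l : ℂ) - μ‖ = |l - μ| := by
        rw [← Complex.ofReal_sub, Complex.norm_real, Real.norm_eq_abs]
      rw [h5]
      refine div_le_div_of_nonneg_right ((norm_sub_le _ _).trans ?_) (abs_nonneg _)
      have h6 : ∀ s : ℝ, ‖Complex.exp (Complex.I * (l - μ) * s)‖ = 1 := by
        intro s
        rw [show Complex.I * ((l : ℂ) - μ) * s = ((l - μ) * s : ℝ) * Complex.I by
          push_cast; ring, Complex.norm_exp_ofReal_mul_I]
      rw [h6, h6]
      norm_num
    have h7 := norm_sub_le_norm_add (C μ * T)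
      (∑ l ∈ Λ.erase μ, C l * ∫ t in (0 : ℝ)..T, Complex.exp (Complex.I * (l - μ) * t))
    rw [norm_mul, Complex.norm_real, Real.norm_eq_abs, abs_of_pos hT] at h7
    rw [sub_zero, abs_of_pos hT] at h1
    linarith
  by_contra! hlt
  have hpos : 0 < ‖C μ‖ - B := sub_pos.2 hlt
  have := key ((D + 1) / (‖C μ‖ - B)) (by positivity)
  have h2 : (D + 1) / (‖C μ‖ - B) * (‖C μ‖ - B) = D + 1 := div_mul_cancel₀ _ hpos.ne'
  linarith

theorem map_sum_addChar {A M α : Type*} [AddCommMonoid A] [CommMonoid M] (χ : AddChar A M)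
    (s : Finset α) (f : α → A) : χ (∑ a ∈ s, f a) = ∏ a ∈ s, χ (f a) := by
  classical
  induction s using Finset.induction_on with
  | empty => simp
  | insert a s ha ih => rw [Finset.sum_insert ha, Finset.prod_insert ha, χ.map_add_eq_mul, ih]

/-- The continuous additive character `x ↦ exp (i t x)` of `ℝ`. -/
noncomputable def circleExpAddChar (t : ℝ) : AddChar ℝ Circle where
  toFun x := Circle.exp (t * x)
  map_zero_eq_one' := by simp
  map_add_eq_mul' x y := by rw [mul_add, Circle.exp_add]

theorem circleExpAddChar_apply (t x : ℝ) : circleExpAddChar t x = Circle.exp (t * x) := rfl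

/-- Expand the p-th power and group the terms by frequency. As χ is additive, all terms of frequency
l carry the same twist (χ l)⁻¹, so nothing cancels and the coefficient at l has modulus `N l`, at
most B^p. These moduli add up to the left side, and there are at most (p + 1)^card α frequencies. -/
theorem card_pow_le_of_norm_sum_exp_le {α : Type*} [Fintype α] (θ : α → ℝ) (χ : AddChar ℝ Circle)
    (B : ℝ) (h : ∀ t : ℝ, ‖∑ a, ((Circle.exp (t * θ a) * (χ (θ a))⁻¹ : Circle) : ℂ)‖ ≤ B) (p : ℕ) :
    (Fintype.card α : ℝ) ^ p ≤ (p + 1) ^ Fintype.card α * B ^ p := by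
  classical
  set S := Finset.piAntidiag (Finset.univ : Finset α) p
  set fr : (α → ℕ) → ℝ := fun k => ∑ a, k a * θ a
  set N : ℝ → ℕ := fun l => ∑ k ∈ S with fr k = l, Nat.multinomial Finset.univ k
  have hsum : ∑ l ∈ S.image fr, N l = Fintype.card α ^ p := by
    have h1 := Finset.sum_pow_eq_sum_piAntidiag (Finset.univ : Finset α) (fun _ => (1 : ℕ)) p
    simp only [Finset.sum_const, Finset.card_univ, smul_eq_mul, mul_one, one_pow,
      Finset.prod_const_one, Nat.cast_id] at h1
    rw [h1]
    exact Finset.sum_fiberwise_of_maps_to (fun k hk => Finset.mem_image_of_mem fr hk) _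
  have hpow : ∀ t : ℝ, (∑ a, ((Circle.exp (t * θ a) * (χ (θ a))⁻¹ : Circle) : ℂ)) ^ p =
      ∑ l ∈ S.image fr, ((N l : ℂ) * ((χ l)⁻¹ : Circle)) * Circle.exp (t * l) := by
    intro t
    rw [Finset.sum_pow_eq_sum_piAntidiag]
    rw [← Finset.sum_fiberwise_of_maps_to (fun k hk => Finset.mem_image_of_mem fr hk)]
    refine Finset.sum_congr rfl fun l _ => ?_
    simp only [N]
    push_cast
    rw [mul_assoc, Finset.sum_mul]
    refine Finset.sum_congr rfl fun k hk => ?_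
    congr 1
    rw [← (Finset.mem_filter.1 hk).2]
    have h1 : ∏ a, (Circle.exp (t * θ a) * (χ (θ a))⁻¹) ^ k a =
        (χ (fr k))⁻¹ * Circle.exp (t * fr k) := by
      have e1 : χ (fr k) = ∏ a, χ (θ a) ^ k a := by
        rw [map_sum_addChar]
        refine Finset.prod_congr rfl fun a _ => ?_
        rw [← nsmul_eq_mul, AddChar.map_nsmul_eq_pow]
      have e2 : Circle.exp (t * fr k) = ∏ a, Circle.exp (t * θ a) ^ k a := by
        have := map_sum_addChar (circleExpAddChar t) Finset.univ fun a => k a * θ a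
        simp only [circleExpAddChar_apply] at this
        rw [this]
        refine Finset.prod_congr rfl fun a _ => ?_
        rw [← Circle.exp_nsmul, nsmul_eq_mul]
        congr 1
        ring
      simp only [mul_pow, Finset.prod_mul_distrib, e1, e2, inv_pow, Finset.prod_inv_distrib]
      exact mul_comm _ _
    have h2 := congrArg Circle.coeHom h1
    rw [map_prod, map_mul] at h2
    simp only [map_pow] at h2
    simpa only [show ∀ z, Circle.coeHom z = (z : ℂ) from fun _ => rfl, Circle.coe_mul,
      Circle.coe_inv, Circle.coe_exp, Complex.ofReal_mul] using h2
  have hN : ∀ l ∈ S.image fr, (N l : ℝ) ≤ B ^ p := by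
    intro l hl
    have h1 := norm_coeff_le_of_norm_sum_exp_le (S.image fr)
      (fun l => (N l : ℂ) * ((χ l)⁻¹ : Circle)) (B ^ p) (fun t => by
        rw [← hpow, norm_pow]
        exact pow_le_pow_left₀ (norm_nonneg _) (h t) p) hl
    simpa only [norm_mul, Circle.norm_coe, mul_one, Complex.norm_natCast] using h1
  have hB : 0 ≤ B := (norm_nonneg _).trans (h 0)
  have hcard : (S.image fr).card ≤ (p + 1) ^ Fintype.card α := by
    refine Finset.card_image_le.trans ?_
    have h1 : S ⊆ Fintype.piFinset fun _ : α => Finset.range (p + 1) := by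
      intro k hk
      rw [Fintype.mem_piFinset]
      intro a
      rw [Finset.mem_range, Nat.lt_succ_iff, ← (Finset.mem_piAntidiag.1 hk).1]
      exact Finset.single_le_sum (fun _ _ => Nat.zero_le _) (Finset.mem_univ a)
    refine (Finset.card_le_card h1).trans ?_
    simp
  calc (Fintype.card α : ℝ) ^ p = ∑ l ∈ S.image fr, (N l : ℝ) := by exact_mod_cast hsum.symm
    _ ≤ (S.image fr).card • B ^ p := Finset.sum_le_card_nsmul _ _ _ hN
    _ = (S.image fr).card * B ^ p := nsmul_eq_mul _ _
    _ ≤ _ := by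
      refine mul_le_mul_of_nonneg_right ?_ (pow_nonneg hB p)
      exact_mod_cast hcard

/-- In the previous bound the factor (p + 1)^card α is polynomial in p, so letting p grow removes
it. An intermediate b replaces B to keep the denominator positive. -/
theorem card_le_of_norm_sum_exp_le {α : Type*} [Fintype α] (θ : α → ℝ) (χ : AddChar ℝ Circle)
    (B : ℝ) (h : ∀ t : ℝ, ‖∑ a, ((Circle.exp (t * θ a) * (χ (θ a))⁻¹ : Circle) : ℂ)‖ ≤ B) :
    (Fintype.card α : ℝ) ≤ B := by
  by_contra! hlt
  have hB : 0 ≤ B := (norm_nonneg _).trans (h 0)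
  set K := Fintype.card α
  obtain ⟨b, hb, hbK⟩ := exists_between hlt
  have hb0 : 0 < b := hB.trans_lt hb
  have hr : 1 < (K : ℝ) / b := (one_lt_div hb0).2 hbK
  have key := card_pow_le_of_norm_sum_exp_le θ χ b fun t => (h t).trans hb.le
  have hlim := tendsto_pow_const_div_const_pow_of_one_lt K hr
  have hev := (hlim.eventually_lt_const (show (0 : ℝ) < 1 / 2 ^ K by positivity)).and
    (Filter.eventually_ge_atTop 1)
  obtain ⟨p, hp, hp1⟩ := hev.exists
  have h1 := key p
  have hp1' : (1 : ℝ) ≤ p := by exact_mod_cast hp1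
  have h2 : ((p : ℝ) + 1) ^ K ≤ 2 ^ K * p ^ K := by
    rw [← mul_pow]
    exact pow_le_pow_left₀ (by positivity) (by linarith) K
  have hbp : 0 < b ^ p := pow_pos hb0 p
  have h3 : ((K : ℝ) / b) ^ p ≤ 2 ^ K * p ^ K := by
    rw [div_pow, div_le_iff₀ hbp]
    exact h1.trans (mul_le_mul_of_nonneg_right h2 hbp.le)
  have hrp : 0 < ((K : ℝ) / b) ^ p := pow_pos (by linarith) p
  rw [div_lt_div_iff₀ hrp (by positivity)] at hp
  linarith

/-- Equality in the triangle inequality: after rotation by u, which makes the sum a positive real,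
every term must have real part equal to its weight. -/
theorem eq_of_sum_le_norm_sum {ι : Type*} [Fintype ι] {w : ι → ℝ} (hw : ∀ i, 0 < w i)
    (z : ι → Circle) (h : ∑ i, w i ≤ ‖∑ i, (w i : ℂ) * z i‖) (i j : ι) : z i = z j := by
  set S := ∑ i, (w i : ℂ) * z i
  have hS : 0 < ‖S‖ := (Finset.sum_pos (fun i _ => hw i) ⟨i, Finset.mem_univ i⟩).trans_le h
  set u : ℂ := (starRingEnd ℂ) S / ‖S‖
  have hu : ‖u‖ = 1 := by
    rw [norm_div, RCLike.norm_conj, Complex.norm_real, norm_norm, div_self hS.ne']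
  have hre : ∀ i, ((z i : ℂ) * u).re ≤ 1 := fun i =>
    (Complex.re_le_norm _).trans (by rw [norm_mul, Circle.norm_coe, hu, one_mul])
  have hsum : ∑ i, w i * ((z i : ℂ) * u).re = ‖S‖ := by
    have h1 : S * u = ‖S‖ := by
      rw [mul_div_assoc', Complex.mul_conj', sq, mul_div_assoc, div_self, mul_one]
      exact_mod_cast hS.ne'
    have h2 := congrArg Complex.re h1
    rw [Complex.ofReal_re, Finset.sum_mul, Complex.re_sum] at h2
    rw [← h2]
    refine Finset.sum_congr rfl fun i _ => ?_
    rw [mul_assoc, Complex.re_ofReal_mul]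
  have hle : ∀ i ∈ Finset.univ, w i * ((z i : ℂ) * u).re ≤ w i := fun i _ =>
    mul_le_of_le_one_right (hw i).le (hre i)
  have heq := (Finset.sum_eq_sum_iff_of_le hle).1
    (le_antisymm (Finset.sum_le_sum hle) (hsum ▸ h))
  have hone : ∀ i, (z i : ℂ) * u = 1 := by
    intro i
    have h1 : ((z i : ℂ) * u).re = 1 := by
      have := heq i (Finset.mem_univ i)
      exact mul_left_cancel₀ (hw i).ne' (this.trans (mul_one _).symm)
    have h2 : ‖(z i : ℂ) * u‖ = 1 := by rw [norm_mul, Circle.norm_coe, hu, one_mul]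
    have h3 := Complex.sq_norm ((z i : ℂ) * u)
    rw [h2, Complex.normSq_apply, h1] at h3
    refine Complex.ext h1 ?_
    have : ((z i : ℂ) * u).im * ((z i : ℂ) * u).im = 0 := by linarith
    simpa using this
  have hu0 : u ≠ 0 := norm_ne_zero_iff.1 (by rw [hu]; exact one_ne_zero)
  exact Circle.ext (mul_right_cancel₀ hu0 ((hone i).trans (hone j).symm))

/-- **Kronecker's approximation theorem**: the values of an arbitrary additive character of `ℝ` at
finitely many real numbers can be approximated by those of continuous characters. -/
theorem addChar_mem_closure_range_exp {ι : Type*} [Fintype ι] (θ : ι → ℝ) (χ : AddChar ℝ Circle) :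
    (fun i => χ (θ i)) ∈ closure (Set.range fun (t : ℝ) (i : ι) => Circle.exp (t * θ i)) := by
  set H := closure (Set.range fun (t : ℝ) (i : ι) => Circle.exp (t * θ i))
  have hH : IsCompact H := isClosed_closure.isCompact
  -- The extra coordinate `none`, constantly 1, pins the common phase. At a maximum of the modulus
  -- all terms are equal, hence all equal to 1, which means z i = χ (θ i).
  set G : (ι → Circle) → Option ι → Circle := fun z o => o.elim 1 fun i => z i * (χ (θ i))⁻¹
  have hG : Continuous fun z => ‖∑ o, (G z o : ℂ)‖ := by
    refine continuous_norm.comp (continuous_finsetSum _ fun o _ => ?_)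
    cases o <;> simp only [G, Option.elim] <;> fun_prop
  obtain ⟨z, hz, hmax⟩ := hH.exists_isMaxOn
    ⟨_, subset_closure (Set.mem_range_self (0 : ℝ))⟩ hG.continuousOn
  have hle := card_le_of_norm_sum_exp_le (fun o : Option ι => o.elim 0 θ) χ (‖∑ o, (G z o : ℂ)‖) (by
    intro t
    have h1 := hmax (subset_closure (Set.mem_range_self t))
    simp only [Set.mem_ofPred_eq] at h1
    refine le_of_eq_of_le ?_ h1
    congr 1
    refine Finset.sum_congr rfl fun o _ => ?_
    cases o <;> simp [G])
  have heq := eq_of_sum_le_norm_sum (w := fun _ : Option ι => 1) (fun _ => one_pos) (G z)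
    (by simpa using hle)
  convert hz using 1
  funext i
  have := heq (some i) none
  simp only [G, Option.elim] at this
  exact (mul_inv_eq_one.1 this).symm

/-- The map φ l ↦ ψ l / 2 in ℚ/ℤ is well defined on the range of φ by the parity hypothesis. It
extends to ℝ because ℚ/ℤ is injective, and q ↦ exp(2πiq) carries it to the circle. No continuity is
obtained or needed. -/
theorem exists_addChar_extension {L : Type*} [AddCommGroup L] (φ : L →+ ℝ) (ψ : L →+ ℤ)
    (h : ∀ l, φ l = 0 → Even (ψ l)) :
    ∃ χ : AddChar ℝ Circle, ∀ l, χ (φ l) = Circle.exp Real.pi ^ ψ l := by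
  set half : AddCircle (1 : ℚ) := ((1 / 2 : ℚ) : AddCircle (1 : ℚ))
  have hhalf : (2 : ℤ) • half = 0 := by
    rw [← AddCircle.coe_zsmul, AddCircle.coe_eq_zero_iff]
    exact ⟨1, by norm_num⟩
  set g : L →+ AddCircle (1 : ℚ) := ((zmultiplesHom _) half).comp ψ
  have hg : φ.ker ≤ g.ker := by
    intro l hl
    obtain ⟨m, hm⟩ := h l hl
    rw [AddMonoidHom.mem_ker]
    simp only [g, AddMonoidHom.comp_apply, zmultiplesHom_apply]
    rw [hm, ← mul_two, mul_smul, hhalf, smul_zero]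
  set c : φ.range →+ AddCircle (1 : ℚ) :=
    (QuotientAddGroup.lift φ.ker g hg).comp
      (QuotientAddGroup.quotientKerEquivRange φ).symm.toAddMonoidHom
  have hc : ∀ l, c ⟨φ l, l, rfl⟩ = ψ l • half := by
    intro l
    have : (QuotientAddGroup.quotientKerEquivRange φ).symm ⟨φ l, l, rfl⟩ = (l : L ⧸ φ.ker) := by
      rw [AddEquiv.symm_apply_eq]
      rfl
    change QuotientAddGroup.lift φ.ker g hg
      ((QuotientAddGroup.quotientKerEquivRange φ).symm ⟨φ l, l, rfl⟩) = _
    rw [this]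
    rfl
  obtain ⟨d, hd⟩ := CharacterModule.dual_surjective_of_injective
    (φ.range.subtype.toIntLinearMap) Subtype.val_injective c
  set e : AddCircle (1 : ℚ) →+ Additive Circle :=
    QuotientAddGroup.lift (AddSubgroup.zmultiples (1 : ℚ))
      (AddMonoidHom.mk' (fun q : ℚ => Additive.ofMul (Circle.exp (2 * Real.pi * q))) (by
        intro a b
        rw [← ofMul_mul, ← Circle.exp_add]
        congr 2
        push_cast
        ring)) (by
      intro q hq
      obtain ⟨m, rfl⟩ := AddSubgroup.mem_zmultiples_iff.1 hq
      rw [AddMonoidHom.mem_ker]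
      change Additive.ofMul (Circle.exp (2 * Real.pi * ((m • (1 : ℚ) : ℚ) : ℝ))) = 0
      rw [show ((m • (1 : ℚ) : ℚ) : ℝ) = (m : ℝ) by simp, Circle.exp_two_pi_mul_int]
      rfl)
  have he : e half = Additive.ofMul (Circle.exp Real.pi) := by
    change Additive.ofMul (Circle.exp (2 * Real.pi * ((1 / 2 : ℚ) : ℝ))) = _
    congr 2
    push_cast
    ring
  refine ⟨⟨fun x => (e (d x)).toMul, ?_, ?_⟩, fun l => ?_⟩
  · rw [map_zero, map_zero]; rfl
  · intro x y
    rw [map_add, map_add]; rfl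
  · change (e (d (φ l))).toMul = _
    have h1 : d (φ l) = ψ l • half := by
      rw [← hc, ← hd]
      rfl
    rw [h1, map_zsmul, he]
    rfl

/-! ### Transfer between corners as a parity condition -/

/-- The parity condition on integer relations between eigenvalues that governs pretty good state
transfer between corners. -/
def ParityCondition {k : ℕ} (n : Fin k → ℕ) : Prop :=
  ∀ l : (i : Fin k) → Fin (n i) → ℤ, (∀ i, ∑ r, l i r = 0) →
    ∑ i, ∑ r, (l i r : ℝ) * pathEigenvalue (n i) r = 0 →
    ∀ i, Even (∑ r : Fin (n i), if Odd (r : ℕ) then l i r else 0)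

section Corners

variable {k : ℕ} (n : Fin k → ℕ)

/-- The closure of the set of phases `exp (i t θ)` of all eigenvalues of all factors. -/
noncomputable def phaseClosure : Set ((Σ i : Fin k, Fin (n i)) → Circle) :=
  closure (Set.range fun (t : ℝ) (a : Σ i : Fin k, Fin (n i)) =>
    Circle.exp (t * pathEigenvalue (n a.1) a.2))

/-- The sign by which the `r`-th eigenvector changes between the origin and a corner `b`. -/
noncomputable def cornerSign {n : Fin k → ℕ} (b : (i : Fin k) → Fin (n i)) (i : Fin k)
    (r : Fin (n i)) : Circle :=
  if (b i : ℕ) = 0 then 1 else Circle.exp Real.pi ^ (r : ℕ)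

theorem coe_cornerSign {n : Fin k → ℕ} (b : (i : Fin k) → Fin (n i)) (i : Fin k) (r : Fin (n i)) :
    (cornerSign b i r : ℂ) = if (b i : ℕ) = 0 then 1 else (-1) ^ (r : ℕ) := by
  unfold cornerSign
  split_ifs <;> simp

theorem unitSineVec_corner {n : Fin k → ℕ} {z b : (i : Fin k) → Fin (n i)}
    (hz : ∀ i, (z i : ℕ) = 0) (hb : b ∈ corners n) (i : Fin k) (r : Fin (n i)) :
    ((unitSineVec (n i) r (b i) * unitSineVec (n i) r (z i) : ℝ) : ℂ) =
      (unitSineVec (n i) r (z i) ^ 2 : ℝ) * cornerSign b i r := by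
  rw [coe_cornerSign]
  split_ifs with h
  · rw [show b i = z i from Fin.ext (h.trans (hz i).symm)]
    push_cast
    ring
  · have : b i = (z i).rev := by
      refine Fin.ext ?_
      rw [Fin.val_rev, hz]
      have := (hb i).resolve_left h
      omega
    rw [this, unitSineVec_rev]
    push_cast
    ring

/-- The modulus of the amplitude from the origin `z` to the corner `b`, as a function of the
phases of the eigenvalues. -/
noncomputable def cornerAmplitude {n : Fin k → ℕ} (z b : (i : Fin k) → Fin (n i))
    (ζ : (Σ i : Fin k, Fin (n i)) → Circle) : ℝ :=
  ∏ i, ‖∑ r, ((unitSineVec (n i) r (z i) ^ 2 : ℝ) : ℂ) *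
    ((cornerSign b i r * ζ ⟨i, r⟩ : Circle) : ℂ)‖

theorem continuous_cornerAmplitude {n : Fin k → ℕ} (z b : (i : Fin k) → Fin (n i)) :
    Continuous (cornerAmplitude z b) := by
  unfold cornerAmplitude
  fun_prop

theorem norm_transitionMatrix_corner {n : Fin k → ℕ} {z b : (i : Fin k) → Fin (n i)}
    (hz : ∀ i, (z i : ℕ) = 0) (hb : b ∈ corners n) (t : ℝ) :
    ‖transitionMatrix (pathProduct n) t b z‖ =
      cornerAmplitude z b fun a => Circle.exp (-t * pathEigenvalue (n a.1) a.2) := by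
  rw [cornerAmplitude, transitionMatrix_pathProduct, norm_prod]
  refine Finset.prod_congr rfl fun i _ => ?_
  congr 1
  refine Finset.sum_congr rfl fun r _ => ?_
  rw [unitSineVec_corner hz hb, Circle.coe_mul, mul_assoc, neg_mul]

theorem sum_unitSineVec_sq_origin (m : ℕ) (z : Fin m) : ∑ r, unitSineVec m r z ^ 2 = 1 := by
  have h1 : (Matrix.of fun r x => unitSineVec m r x) *
      (Matrix.of fun r x => unitSineVec m r x).transpose = 1 := by
    ext r s
    simp only [Matrix.mul_apply, Matrix.transpose_apply, Matrix.of_apply, Matrix.one_apply]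
    exact sum_unitSineVec_mul m r s
  rw [mul_eq_one_comm] at h1
  have h2 := congrFun (congrFun h1 z) z
  simpa [Matrix.mul_apply, sq] using h2

theorem norm_weighted_sum_circle_le {m : ℕ} (z : Fin m) (u : Fin m → Circle) :
    ‖∑ r, ((unitSineVec m r z ^ 2 : ℝ) : ℂ) * u r‖ ≤ 1 := by
  rw [← sum_unitSineVec_sq_origin m z]
  refine (norm_sum_le _ _).trans (Finset.sum_le_sum fun r _ => ?_)
  rw [norm_mul, Circle.norm_coe, mul_one, Complex.norm_real, Real.norm_eq_abs,
    abs_of_nonneg (sq_nonneg _)]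

/-- By compactness, PGST means that the amplitude reaches 1 on the closure of the phases. Each
factor is a convex combination of unit numbers with positive weights, so it has modulus 1 only when
all of them coincide. -/
theorem pgst_corner_iff {n : Fin k → ℕ} {z b : (i : Fin k) → Fin (n i)}
    (hz : ∀ i, (z i : ℕ) = 0) (hb : b ∈ corners n) :
    PGST (pathProduct n) z b ↔ ∃ ζ ∈ phaseClosure n, ∀ i r s,
      cornerSign b i r * ζ ⟨i, r⟩ = cornerSign b i s * ζ ⟨i, s⟩ := by
  have hF := continuous_cornerAmplitude z b
  have hw : ∀ i r, 0 < unitSineVec (n i) r (z i) ^ 2 := fun i r =>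
    pow_pos (unitSineVec_zero_pos _ _ _ (hz i)) 2
  constructor
  · intro h
    have hH : IsCompact (phaseClosure n) := isClosed_closure.isCompact
    obtain ⟨ζ, hζ, hmax⟩ := hH.exists_isMaxOn
      ⟨_, subset_closure (Set.mem_range_self (0 : ℝ))⟩ hF.continuousOn
    refine ⟨ζ, hζ, fun i => ?_⟩
    have h1 : 1 ≤ cornerAmplitude z b ζ := by
      refine le_of_forall_sub_le fun ε hε => ?_
      obtain ⟨τ, hτ⟩ := h ε hε
      rw [norm_transitionMatrix_corner hz hb] at hτ
      exact hτ.le.trans (hmax (subset_closure (Set.mem_range_self (-τ))))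
    refine eq_of_sum_le_norm_sum (hw i) (fun r => cornerSign b i r * ζ ⟨i, r⟩) ?_
    rw [sum_unitSineVec_sq_origin]
    refine h1.trans ?_
    rw [cornerAmplitude, ← Finset.mul_prod_erase _ _ (Finset.mem_univ i)]
    exact mul_le_of_le_one_right (norm_nonneg _) (Finset.prod_le_one (fun _ _ => norm_nonneg _)
      fun j _ => norm_weighted_sum_circle_le (z j) fun r => cornerSign b j r * ζ ⟨j, r⟩)
  · rintro ⟨ζ, hζ, h⟩ ε hε
    have h1 : cornerAmplitude z b ζ = 1 := by
      refine Finset.prod_eq_one fun i _ => ?_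
      simp_rw [fun r => h i r (z i)]
      rw [← Finset.sum_mul, norm_mul, Circle.norm_coe, mul_one, ← Complex.ofReal_sum,
        sum_unitSineVec_sq_origin]
      simp
    obtain ⟨_, hζ', t, rfl⟩ := mem_closure_iff.1 hζ _ (isOpen_lt continuous_const hF)
      (show 1 - ε < cornerAmplitude z b ζ by rw [h1]; linarith)
    refine ⟨-t, ?_⟩
    rw [norm_transitionMatrix_corner hz hb, neg_neg]
    exact hζ'

/-- The equation is a closed condition and holds along the orbit t ↦ exp(itθ). -/
theorem prod_zpow_eq_one_of_mem_phaseClosure {n : Fin k → ℕ}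
    {ζ : (Σ i : Fin k, Fin (n i)) → Circle} (hζ : ζ ∈ phaseClosure n)
    {l : (i : Fin k) → Fin (n i) → ℤ}
    (hl : ∑ i, ∑ r, (l i r : ℝ) * pathEigenvalue (n i) r = 0) :
    ∏ i, ∏ r, ζ ⟨i, r⟩ ^ l i r = 1 := by
  have hclosed : IsClosed {ζ : (Σ i : Fin k, Fin (n i)) → Circle |
      ∏ i, ∏ r, ζ ⟨i, r⟩ ^ l i r = 1} := by
    refine isClosed_eq ?_ continuous_const
    fun_prop
  refine closure_minimal ?_ hclosed hζ
  rintro _ ⟨t, rfl⟩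
  have h := map_sum_addChar (circleExpAddChar t) Finset.univ
    fun i => ∑ r, (l i r : ℝ) * pathEigenvalue (n i) r
  rw [hl, AddChar.map_zero_eq_one] at h
  change _ = _
  rw [h]
  refine Finset.prod_congr rfl fun i _ => ?_
  rw [map_sum_addChar]
  refine Finset.prod_congr rfl fun r _ => ?_
  rw [← zsmul_eq_mul, AddChar.map_zsmul_eq_zpow]
  rfl

theorem exp_pi_zpow_eq_one_iff (m : ℤ) : Circle.exp Real.pi ^ m = 1 ↔ Even m := by
  have h : (Circle.exp Real.pi : ℂ) = -1 := by simp
  rw [← Circle.coe_eq_one, Circle.coe_zpow, h]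
  constructor
  · intro h1
    by_contra h2
    rw [Int.not_even_iff_odd] at h2
    rw [h2.neg_one_zpow] at h1
    norm_num at h1
  · exact fun h => h.neg_one_zpow

theorem prod_zpow_eq_zpow_sum {G α : Type*} [CommGroup G] (s : Finset α) (f : α → ℤ) (a : G) :
    ∏ i ∈ s, a ^ f i = a ^ ∑ i ∈ s, f i := by
  classical
  induction s using Finset.induction_on with
  | empty => simp
  | insert i s hi ih => rw [Finset.prod_insert hi, Finset.sum_insert hi, zpow_add, ih]

theorem exp_pi_pow_eq (m : ℕ) :
    Circle.exp Real.pi ^ m = Circle.exp Real.pi ^ (if Odd m then 1 else 0 : ℤ) := by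
  have h : Circle.exp Real.pi ^ (2 : ℕ) = 1 := (exp_pi_zpow_eq_one_iff 2).2 even_two
  split_ifs with h1
  · obtain ⟨a, rfl⟩ := h1
    rw [pow_succ, pow_mul, h, one_pow, one_mul, zpow_one]
  · rw [Nat.not_odd_iff_even] at h1
    obtain ⟨a, rfl⟩ := h1
    rw [← two_mul, pow_mul, h, one_pow, zpow_zero]

theorem forall_pgst_corner_iff {n : Fin k → ℕ} {z : (i : Fin k) → Fin (n i)}
    (hz : ∀ i, (z i : ℕ) = 0) (hn : ∀ i, 2 ≤ n i) :
    (∀ b ∈ corners n, PGST (pathProduct n) z b) ↔ ParityCondition n := by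
  constructor
  · intro h l hl0 hl i
    -- The corner reflected in coordinate i alone detects the parity of factor i. In each factor the
    -- common phase γ disappears because the coefficients sum to 0.
    set b : (j : Fin k) → Fin (n j) := fun j => if j = i then (z j).rev else z j
    have hb : b ∈ corners n := by
      intro j
      by_cases hj : j = i
      · right
        simp only [b, hj, if_true, Fin.val_rev, hz]
        have := hn i
        omega
      · left
        simp only [b, hj, if_false, hz]
    obtain ⟨ζ, hζ, hsign⟩ := (pgst_corner_iff hz hb).1 (h b hb)
    have h1 := prod_zpow_eq_one_of_mem_phaseClosure hζ hl
    have h2 : ∀ j, ∏ r, ζ ⟨j, r⟩ ^ l j r =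
        if j = i then Circle.exp Real.pi ^ (-∑ r : Fin (n j), if Odd (r : ℕ) then l j r else 0)
        else 1 := by
      intro j
      obtain ⟨γ, e1⟩ : ∃ γ, ∀ r, ζ ⟨j, r⟩ = γ * (cornerSign b j r)⁻¹ := by
        refine ⟨cornerSign b j (z j) * ζ ⟨j, z j⟩, fun r => ?_⟩
        rw [← hsign j r (z j), mul_comm, inv_mul_cancel_left]
      simp_rw [e1, mul_zpow, Finset.prod_mul_distrib]
      rw [prod_zpow_eq_zpow_sum, hl0, zpow_zero, one_mul]
      split_ifs with hj
      · rw [← Finset.sum_neg_distrib, ← prod_zpow_eq_zpow_sum]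
        refine Finset.prod_congr rfl fun r _ => ?_
        have : ((b j : Fin (n j)) : ℕ) ≠ 0 := by
          simp only [b, hj, if_true, Fin.val_rev, hz]
          have := hn i
          omega
        rw [cornerSign, if_neg this, exp_pi_pow_eq, inv_zpow', ← zpow_mul]
        congr 1
        split_ifs <;> ring
      · refine Finset.prod_eq_one fun r _ => ?_
        have : ((b j : Fin (n j)) : ℕ) = 0 := by simp only [b, hj, if_false, hz]
        rw [cornerSign, if_pos this, inv_one, one_zpow]
    simp_rw [h2] at h1
    rw [Finset.prod_ite_eq' Finset.univ i, if_pos (Finset.mem_univ i),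
      exp_pi_zpow_eq_one_iff, even_neg] at h1
    exact h1
  · intro h b hb
    rw [pgst_corner_iff hz hb]
    -- Lattice of coefficients with zero sum in each factor; φ is the value of a combination and ψ
    -- the sign exponent required by the corner b. A character χ with χ ∘ φ = (-1)^ψ supplies the
    -- phases.
    set L : AddSubgroup ((i : Fin k) → Fin (n i) → ℤ) :=
      { carrier := {l | ∀ i, ∑ r, l i r = 0}
        zero_mem' := by intro i; simp
        add_mem' := by
          intro l l' hl hl' i
          simp only [Pi.add_apply, Finset.sum_add_distrib]
          rw [hl i, hl' i, add_zero]
        neg_mem' := by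
          intro l hl i
          simp only [Pi.neg_apply, Finset.sum_neg_distrib]
          rw [hl i, neg_zero] }
    set φ : L →+ ℝ := AddMonoidHom.mk'
      (fun l => ∑ i, ∑ r, (l.1 i r : ℝ) * pathEigenvalue (n i) r) (by
        intro l l'
        simp [add_mul, Finset.sum_add_distrib])
    set ψ : L →+ ℤ := AddMonoidHom.mk'
      (fun l => ∑ i, if (b i : ℕ) = 0 then 0 else
        ∑ r : Fin (n i), if Odd (r : ℕ) then l.1 i r else 0) (by
        intro l l'
        rw [← Finset.sum_add_distrib]
        refine Finset.sum_congr rfl fun i _ => ?_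
        split_ifs
        · simp
        · rw [← Finset.sum_add_distrib]
          refine Finset.sum_congr rfl fun r _ => ?_
          split_ifs <;> simp)
    obtain ⟨χ, hχ⟩ := exists_addChar_extension φ ψ (by
      intro l hl
      change Even (∑ i, if (b i : ℕ) = 0 then 0 else
        ∑ r : Fin (n i), if Odd (r : ℕ) then l.1 i r else 0)
      refine Finset.even_sum _ fun i _ => ?_
      split_ifs
      · exact Even.zero
      · exact h l.1 l.2 hl i)
    refine ⟨_, addChar_mem_closure_range_exp
      (fun a : Σ i : Fin k, Fin (n i) => pathEigenvalue (n a.1) a.2) χ, ?_⟩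
    suffices key : ∀ i r, cornerSign b i r * χ (pathEigenvalue (n i) r) =
        χ (pathEigenvalue (n i) (z i)) from fun i r s => (key i r).trans (key i s).symm
    intro i r
    -- The difference of two basis vectors of factor i compares the phases of its eigenvalues r and
    -- `z i`.
    set l : (j : Fin k) → Fin (n j) → ℤ :=
      Pi.single i (Pi.single (z i) 1 - Pi.single r 1)
    have hl : l ∈ L := by
      intro j
      by_cases hj : j = i
      · subst hj
        simp [l, Finset.sum_sub_distrib]
      · simp [l, hj]
    have hφ : φ ⟨l, hl⟩ = pathEigenvalue (n i) (z i) - pathEigenvalue (n i) r := by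
      change ∑ j, ∑ s, (l j s : ℝ) * pathEigenvalue (n j) s = _
      rw [Finset.sum_eq_single i]
      · simp [l, sub_mul, Finset.sum_sub_distrib, Pi.single_apply, ite_mul]
      · intro j _ hj
        simp [l, hj]
      · simp
    have hψ : ψ ⟨l, hl⟩ = if (b i : ℕ) = 0 then 0 else -(if Odd (r : ℕ) then 1 else 0) := by
      change (∑ j, if (b j : ℕ) = 0 then 0 else
        ∑ s : Fin (n j), if Odd (s : ℕ) then l j s else 0) = _
      rw [Finset.sum_eq_single i]
      · congr 1
        simp only [l, Pi.single_eq_same, Pi.sub_apply, Pi.single_apply]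
        rw [← Finset.sum_filter, Finset.sum_sub_distrib, Finset.sum_ite_eq', Finset.sum_ite_eq']
        simp [hz]
      · intro j _ hj
        simp [l, hj]
      · simp
    have h1 := hχ ⟨l, hl⟩
    rw [hφ, hψ] at h1
    rw [show χ (pathEigenvalue (n i) (z i)) = χ (pathEigenvalue (n i) (z i) -
      pathEigenvalue (n i) r) * χ (pathEigenvalue (n i) r) by
        rw [← AddChar.map_add_eq_mul, sub_add_cancel], h1, cornerSign]
    congr 1
    split_ifs with hb0 ho
    · rw [zpow_zero]
    · rw [exp_pi_pow_eq, if_pos ho, ← div_eq_one, div_eq_mul_inv, ← zpow_sub]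
      exact (exp_pi_zpow_eq_one_iff _).2 (by decide)
    · rw [exp_pi_pow_eq, if_neg ho, neg_zero]

theorem exists_class_corners_subset_iff {n : Fin k → ℕ} (hn : ∀ i, 2 ≤ n i) :
    (∃ C ∈ (pgstSetoid (pathProduct n)).classes, corners n ⊆ C) ↔ ParityCondition n := by
  set z : (i : Fin k) → Fin (n i) := fun i => ⟨0, by have := hn i; omega⟩
  have hz : ∀ i, (z i : ℕ) = 0 := fun _ => rfl
  have hzc : z ∈ corners n := fun i => Or.inl (hz i)
  rw [← forall_pgst_corner_iff hz hn]
  constructor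
  · rintro ⟨_, ⟨y, rfl⟩, h⟩ b hb
    exact PGST.trans (h hzc) (PGST.symm (h hb))
  · intro h
    exact ⟨_, ⟨z, rfl⟩, fun b hb => (h b hb).symm⟩

end Corners

/-! ### Explicit relations and necessity of the arithmetic conditions -/

/-- For an integer combination `l` of eigenvalues of the path with `n` vertices: the sum of the
coefficients, the value, and the sum of the coefficients of the eigenvalues whose eigenvectors are
antisymmetric. -/
noncomputable def relationTriple (n : ℕ) : (Fin n → ℤ) →+ ℤ × ℝ × ℤ :=
  AddMonoidHom.mk' (fun l => (∑ r, l r, ∑ r, (l r : ℝ) * pathEigenvalue n r,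
    ∑ r : Fin n, if Odd (r : ℕ) then l r else 0)) (by
    intro l l'
    refine Prod.ext ?_ (Prod.ext ?_ ?_)
    · simp [Finset.sum_add_distrib]
    · simp [Finset.sum_add_distrib, add_mul]
    · simp only [Prod.snd_add, ← Finset.sum_add_distrib]
      refine Finset.sum_congr rfl fun r _ => ?_
      split_ifs <;> simp)

theorem ParityCondition.even_of_mem {k : ℕ} {n : Fin k → ℕ} (h : ParityCondition n)
    {v : Fin k → ℝ} {e : Fin k → ℤ} (hmem : ∀ i, ((0 : ℤ), v i, e i) ∈ (relationTriple (n i)).range)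
    (hv : ∑ i, v i = 0) (i : Fin k) : Even (e i) := by
  choose l hl using hmem
  have h1 : ∀ i, ∑ r, l i r = 0 := fun i => congrArg (fun x => x.1) (hl i)
  have h2 : ∀ i, ∑ r, (l i r : ℝ) * pathEigenvalue (n i) r = v i :=
    fun i => congrArg (fun x => x.2.1) (hl i)
  have h3 : ∀ i, (∑ r : Fin (n i), if Odd (r : ℕ) then l i r else 0) = e i :=
    fun i => congrArg (fun x => x.2.2) (hl i)
  rw [← h3]
  refine h l h1 ?_ i
  simp_rw [h2]
  exact hv

/-- Relations with opposite values in two factors, and the zero relation elsewhere, glue to a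
relation of the product. -/
theorem ParityCondition.even_of_mem_of_mem {k : ℕ} {n : Fin k → ℕ} (h : ParityCondition n)
    {i j : Fin k} (hij : i ≠ j) {v : ℝ} {e e' : ℤ}
    (hi : ((0 : ℤ), v, e) ∈ (relationTriple (n i)).range)
    (hj : ((0 : ℤ), -v, e') ∈ (relationTriple (n j)).range) : Even e := by
  have := h.even_of_mem (v := Pi.single i v + Pi.single j (-v))
    (e := Pi.single i e + Pi.single j e') (by
      intro a
      by_cases hai : a = i
      · subst hai
        simpa [hij] using hi
      · by_cases haj : a = j
        · subst haj
          simpa [hai] using hj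
        · simpa [hai, haj] using ⟨0, map_zero (relationTriple (n a))⟩)
    (by simp [Finset.sum_add_distrib]) i
  simpa [hij] using this

theorem ParityCondition.even_of_zero_mem {k : ℕ} {n : Fin k → ℕ} (h : ParityCondition n)
    {i : Fin k} {e : ℤ} (hi : ((0 : ℤ), (0 : ℝ), e) ∈ (relationTriple (n i)).range) : Even e := by
  have := h.even_of_mem (v := 0) (e := Pi.single i e) (by
      intro a
      by_cases hai : a = i
      · subst hai
        simpa using hi
      · simpa [hai] using ⟨0, map_zero (relationTriple (n a))⟩)
    (by simp) i
  simpa using this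

/-- Reduction of x modulo 2(n + 1) and the reflection x ↦ 2(n + 1) - x preserve both the cosine and
the parity of x, and reach 1 ≤ x ≤ n. The eigenvalue index is x - 1, so even x is the antisymmetric
case. -/
theorem cos_mem_range_relationTriple {n x : ℕ} (hx : ¬ n + 1 ∣ x) :
    ((1 : ℤ), 2 * Real.cos (Real.pi * x / (n + 1)), (if Even x then 1 else 0 : ℤ)) ∈
      (relationTriple n).range := by
  have hn : (n : ℝ) + 1 ≠ 0 := by positivity
  obtain ⟨y, hy, q, hxy⟩ : ∃ y < 2 * (n + 1), ∃ q, x = y + 2 * (n + 1) * q :=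
    ⟨x % (2 * (n + 1)), Nat.mod_lt _ (by omega), x / (2 * (n + 1)), (Nat.mod_add_div _ _).symm⟩
  have hy0 : y ≠ 0 := by
    rintro rfl
    exact hx ⟨2 * q, by rw [hxy]; ring⟩
  have hyn : y ≠ n + 1 := by
    rintro rfl
    exact hx ⟨1 + 2 * q, by rw [hxy]; ring⟩
  have hcos : Real.cos (Real.pi * x / (n + 1)) = Real.cos (Real.pi * y / (n + 1)) := by
    rw [hxy, show Real.pi * ((y + 2 * (n + 1) * q : ℕ) : ℝ) / (n + 1) =
      Real.pi * y / (n + 1) + q * (2 * Real.pi) by push_cast; field_simp,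
      Real.cos_add_nat_mul_two_pi]
  have heven : Even x ↔ Even y := by
    rw [hxy, mul_assoc]
    simp [Nat.even_add]
  have key : ∀ r : Fin n, (Odd (r : ℕ) ↔ Even y) →
      pathEigenvalue n r = 2 * Real.cos (Real.pi * y / (n + 1)) →
      ((1 : ℤ), 2 * Real.cos (Real.pi * x / (n + 1)), (if Even x then 1 else 0 : ℤ)) ∈
        (relationTriple n).range := by
    intro r hr hθ
    refine ⟨Pi.single r 1, Prod.ext ?_ (Prod.ext ?_ ?_)⟩
    · change ∑ s, Pi.single r 1 s = (1 : ℤ)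
      simp
    · change ∑ s, ((Pi.single r 1 : Fin n → ℤ) s : ℝ) * pathEigenvalue n s = _
      simp [Pi.single_apply, ite_mul, hθ, hcos]
    · change (∑ s : Fin n, if Odd (s : ℕ) then (Pi.single r 1 : Fin n → ℤ) s else 0) = _
      simp only [heven, ← hr]
      rw [Finset.sum_eq_single r]
      · simp
      · intro s _ hs
        simp [hs]
      · simp
  by_cases hlt : y < n + 1
  · refine key ⟨y - 1, by omega⟩ ?_ ?_
    · simp only [Nat.odd_iff, Nat.even_iff]
      omega
    · simp only [pathEigenvalue]
      rw [Nat.cast_sub (by omega)]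
      simp
  · refine key ⟨2 * (n + 1) - y - 1, by omega⟩ ?_ ?_
    · simp only [Nat.odd_iff, Nat.even_iff]
      omega
    · simp only [pathEigenvalue]
      rw [Nat.cast_sub (by omega), Nat.cast_sub (by omega)]
      push_cast
      rw [show Real.pi * (2 * ((n : ℝ) + 1) - y - 1 + 1) / (n + 1) =
        2 * Real.pi - Real.pi * y / (n + 1) by field_simp; ring, Real.cos_two_pi_sub]

theorem sin_mul_sum_cos (α d : ℝ) (K : ℕ) :
    Real.sin d * ∑ k ∈ Finset.range K, 2 * Real.cos (α + 2 * k * d) =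
      Real.sin (α + (2 * K - 1) * d) - Real.sin (α - d) := by
  induction K with
  | zero => simp [sub_eq_add_neg]
  | succ K ih =>
    rw [Finset.sum_range_succ, mul_add, ih]
    push_cast
    rw [show α + (2 * K - 1) * d = (α + 2 * K * d) - d by ring,
      show α + (2 * ((K : ℝ) + 1) - 1) * d = (α + 2 * K * d) + d by ring, Real.sin_add, Real.sin_sub]
    ring

theorem sin_pi_div_ne_zero {p : ℕ} (hp : 2 ≤ p) : Real.sin (Real.pi / p) ≠ 0 := by
  have h : (2 : ℝ) ≤ p := by exact_mod_cast hp
  refine (Real.sin_pos_of_pos_of_lt_pi (by positivity) ?_).ne'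
  rw [div_lt_iff₀ (by linarith)]
  nlinarith [Real.pi_pos]

/-- The p angles π(a + 2ks)/(n + 1) are spaced by 2π/p, so their cosines sum to 0, and every a + 2ks
has the parity of a. -/
theorem cosine_progression_mem_range {n p s a : ℕ} (hp : 2 ≤ p) (hn : n + 1 = p * s)
    (ha : ¬ s ∣ a) :
    ((p : ℤ), (0 : ℝ), (if Even a then p else 0 : ℤ)) ∈ (relationTriple n).range := by
  have hs : s ≠ 0 := by
    rintro rfl
    simp at hn
  have hsum := (relationTriple n).range.sum_mem (t := Finset.range p)
    (f := fun k => ((1 : ℤ), 2 * Real.cos (Real.pi * ((a + 2 * k * s : ℕ) : ℝ) / (n + 1)),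
      (if Even (a + 2 * k * s) then 1 else 0 : ℤ))) (by
      intro k _
      refine cos_mem_range_relationTriple fun h => ha ?_
      have : s ∣ a + 2 * k * s := (Dvd.intro_left _ hn.symm).trans h
      exact (Nat.dvd_add_left (Dvd.intro_left _ rfl)).1 this)
  convert hsum using 1
  refine Prod.ext ?_ (Prod.ext ?_ ?_)
  · simp [Prod.fst_sum]
  · simp only [Prod.snd_sum, Prod.fst_sum]
    have hnR : (n : ℝ) + 1 = p * s := by exact_mod_cast hn
    have hpR : (p : ℝ) ≠ 0 := by positivity
    have hsR : (s : ℝ) ≠ 0 := by exact_mod_cast hs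
    have h := sin_mul_sum_cos (Real.pi * a / (n + 1)) (Real.pi / p) p
    have h2 : Real.sin (Real.pi * a / (n + 1) + (2 * p - 1) * (Real.pi / p)) =
        Real.sin (Real.pi * a / (n + 1) - Real.pi / p) := by
      rw [← Real.sin_add_two_pi (Real.pi * a / (n + 1) - Real.pi / p)]
      congr 1
      field_simp
      ring
    rw [h2, sub_self] at h
    have h3 := (mul_eq_zero.1 h).resolve_left (sin_pi_div_ne_zero hp)
    rw [← h3]
    refine Finset.sum_congr rfl fun k _ => ?_
    congr 2
    rw [hnR]
    push_cast
    field_simp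
  · simp only [Prod.snd_sum]
    have : ∀ k, Even (a + 2 * k * s) ↔ Even a := by
      intro k
      rw [mul_assoc]
      simp [Nat.even_add]
    simp only [this]
    split_ifs <;> simp

/-- The progressions starting at 2 and at 1 differ by a relation of value 0 whose antisymmetric part
is the odd number p. The bound s ≥ 3 keeps both starting points off the multiples of s. -/
theorem ParityCondition.not_odd_prime_mul {k : ℕ} {n : Fin k → ℕ} (h : ParityCondition n)
    {i : Fin k} {p s : ℕ} (hp : Odd p) (hp2 : 2 ≤ p) (hs : 3 ≤ s) : n i + 1 ≠ p * s := by
  intro hn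
  have h1 := cosine_progression_mem_range (a := 1) hp2 hn
    (fun h => by have := Nat.le_of_dvd one_pos h; omega)
  have h2 := cosine_progression_mem_range (a := 2) hp2 hn
    (fun h => by have := Nat.le_of_dvd two_pos h; omega)
  have h3 := (relationTriple (n i)).range.sub_mem h2 h1
  simp at h3
  have := h.even_of_zero_mem (i := i) (e := p) (by simpa using h3)
  rw [Int.even_coe_nat] at this
  exact Nat.not_even_iff_odd.2 hp this

/-- Under divisibility the first two eigenvalues of path i are also eigenvalues of path j. Their
difference cancels between the two factors and has antisymmetric part 1 in factor i. -/
theorem ParityCondition.not_dvd {k : ℕ} {n : Fin k → ℕ} (h : ParityCondition n)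
    {i j : Fin k} (hij : i ≠ j) (hi : 2 ≤ n i) : ¬ n i + 1 ∣ n j + 1 := by
  rintro ⟨c, hc⟩
  have hc0 : 0 < c := Nat.pos_of_ne_zero fun h0 => by simp [h0] at hc
  have hnot : ∀ x : ℕ, 0 < x → x < n i + 1 → ¬ n i + 1 ∣ x := fun x hx hlt hd => by
    have := Nat.le_of_dvd hx hd
    omega
  have hcos : ∀ x : ℕ, Real.cos (Real.pi * ((c * x : ℕ) : ℝ) / (n j + 1)) =
      Real.cos (Real.pi * x / (n i + 1)) := by
    intro x
    have h1 : (n j : ℝ) + 1 = (n i + 1) * c := by exact_mod_cast hc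
    have h2 : (c : ℝ) ≠ 0 := by positivity
    rw [h1]
    congr 1
    push_cast
    field_simp
  have hi' := (relationTriple (n i)).range.sub_mem
    (cos_mem_range_relationTriple (hnot 2 (by omega) (by omega)))
    (cos_mem_range_relationTriple (hnot 1 (by omega) (by omega)))
  have hj' : ∀ x : ℕ, ¬ n i + 1 ∣ x → ¬ n j + 1 ∣ c * x := by
    intro x hx hd
    rw [hc, mul_comm (n i + 1)] at hd
    exact hx (Nat.dvd_of_mul_dvd_mul_left hc0 hd)
  have hj'' := (relationTriple (n j)).range.sub_mem
    (cos_mem_range_relationTriple (hj' 1 (hnot 1 (by omega) (by omega))))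
    (cos_mem_range_relationTriple (hj' 2 (hnot 2 (by omega) (by omega))))
  rw [hcos, hcos] at hj''
  have h1 := h.even_of_mem_of_mem hij
    (v := 2 * Real.cos (Real.pi * (2 : ℕ) / (n i + 1)) - 2 * Real.cos (Real.pi * (1 : ℕ) / (n i + 1)))
    (e := 1) (by simpa using hi') (by simpa [neg_sub] using hj'')
  exact absurd h1 (by decide)

theorem sum_cos_odd_mul_pi_div (K : ℕ) (hK : 0 < K) :
    ∑ k ∈ Finset.range K, 2 * Real.cos (Real.pi * (2 * k + 1) / (2 * K + 1)) = 1 := by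
  have h := sin_mul_sum_cos (Real.pi / (2 * K + 1 : ℕ)) (Real.pi / (2 * K + 1 : ℕ)) K
  have hne := sin_pi_div_ne_zero (p := 2 * K + 1) (by omega)
  rw [sub_self, Real.sin_zero, sub_zero,
    show Real.pi / (2 * K + 1 : ℕ) + (2 * K - 1) * (Real.pi / (2 * K + 1 : ℕ)) =
      Real.pi - Real.pi / (2 * K + 1 : ℕ) by push_cast; field_simp; ring, Real.sin_pi_sub] at h
  refine Eq.trans ?_ (mul_left_cancel₀ hne (h.trans (mul_one _).symm))
  refine Finset.sum_congr rfl fun k _ => ?_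
  congr 2
  push_cast
  ring

/-- With entries (coefficient sum, value, antisymmetric part), the cosines at odd x < 2K give W =
(K, 1, 0), and the opposite cosines at 2 and 2K - 1 give D = (2, 0, 1). The relation is tD - cW. -/
theorem relation_mem_range_of_prime {n K : ℕ} (hn : n + 1 = 2 * K + 1) (hK : 0 < K) {c t : ℤ}
    (ht : 2 * t = c * K) : ((0 : ℤ), -(c : ℝ), t) ∈ (relationTriple n).range := by
  have hnR : (n : ℝ) + 1 = 2 * K + 1 := by exact_mod_cast hn
  have hlt : ∀ x : ℕ, 0 < x → x < 2 * K + 1 → ¬ n + 1 ∣ x := fun x hx hlt hd => by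
    have := Nat.le_of_dvd hx hd
    omega
  have hW := (relationTriple n).range.sum_mem (t := Finset.range K)
    (f := fun k => ((1 : ℤ), 2 * Real.cos (Real.pi * ((2 * k + 1 : ℕ) : ℝ) / (n + 1)),
      (if Even (2 * k + 1) then 1 else 0 : ℤ))) (fun k hk => cos_mem_range_relationTriple
        (hlt _ (by omega) (by have := Finset.mem_range.1 hk; omega)))
  have hD := (relationTriple n).range.add_mem
    (cos_mem_range_relationTriple (hlt 2 (by omega) (by omega)))
    (cos_mem_range_relationTriple (hlt (2 * K - 1) (by omega) (by omega)))
  convert (relationTriple n).range.sub_mem ((relationTriple n).range.zsmul_mem hD t)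
    ((relationTriple n).range.zsmul_mem hW c) using 1
  refine Prod.ext ?_ (Prod.ext ?_ ?_)
  · simp only [Prod.fst_sub, Prod.smul_fst, Prod.fst_add, Prod.fst_sum]
    simp
    linarith
  · simp only [Prod.fst_sub, Prod.smul_fst, Prod.fst_add, Prod.fst_sum, Prod.snd_sub,
      Prod.smul_snd, Prod.snd_add, Prod.snd_sum]
    have h1 := sum_cos_odd_mul_pi_div K hK
    have h2 : Real.cos (Real.pi * ((2 * K - 1 : ℕ) : ℝ) / (n + 1)) =
        - Real.cos (Real.pi * (2 : ℕ) / (n + 1)) := by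
      rw [← Real.cos_pi_sub, hnR, Nat.cast_sub (by omega)]
      congr 1
      push_cast
      field_simp
      ring
    rw [h2, hnR]
    push_cast
    rw [h1]
    simp
  · simp only [Prod.snd_sub, Prod.smul_snd, Prod.snd_add, Prod.snd_sum]
    have h1 : ¬ Even (2 * K - 1) := by
      rw [Nat.even_iff]
      omega
    simp [h1]

/-- The same cosine sum now sits at even indices and gives W = (K, 1, K); the zero eigenvalue at x =
2K + 1 gives Z = (1, 0, 0). The relation is cK·Z - cW. -/
theorem relation_mem_range_of_two_mul_prime {n K : ℕ} (hn : n + 1 = 2 * (2 * K + 1)) (hK : 0 < K)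
    (c : ℤ) : ((0 : ℤ), -(c : ℝ), -(c * K)) ∈ (relationTriple n).range := by
  have hnR : (n : ℝ) + 1 = 2 * (2 * K + 1) := by exact_mod_cast hn
  have hlt : ∀ x : ℕ, 0 < x → x < 2 * (2 * K + 1) → ¬ n + 1 ∣ x := fun x hx hlt hd => by
    have := Nat.le_of_dvd hx hd
    omega
  have hW := (relationTriple n).range.sum_mem (t := Finset.range K)
    (f := fun k => ((1 : ℤ), 2 * Real.cos (Real.pi * ((2 * (2 * k + 1) : ℕ) : ℝ) / (n + 1)),
      (if Even (2 * (2 * k + 1)) then 1 else 0 : ℤ))) (fun k hk => cos_mem_range_relationTriple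
        (hlt _ (by omega) (by have := Finset.mem_range.1 hk; omega)))
  have hZ := cos_mem_range_relationTriple (hlt (2 * K + 1) (by omega) (by omega))
  convert (relationTriple n).range.sub_mem ((relationTriple n).range.zsmul_mem hZ (c * K))
    ((relationTriple n).range.zsmul_mem hW c) using 1
  refine Prod.ext ?_ (Prod.ext ?_ ?_)
  · simp [Prod.fst_sum]
  · simp only [Prod.fst_sub, Prod.smul_fst, Prod.fst_sum, Prod.snd_sub,
      Prod.smul_snd, Prod.snd_sum]
    have h1 := sum_cos_odd_mul_pi_div K hK
    have h2 : Real.cos (Real.pi * ((2 * K + 1 : ℕ) : ℝ) / (n + 1)) = 0 := by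
      rw [← Real.cos_pi_div_two, hnR]
      congr 1
      push_cast
      field_simp
    rw [h2]
    have h3 : ∀ k : ℕ, Real.pi * ((2 * (2 * k + 1) : ℕ) : ℝ) / (n + 1) =
        Real.pi * (2 * k + 1) / (2 * K + 1) := by
      intro k
      rw [hnR]
      push_cast
      field_simp
    simp_rw [h3]
    rw [h1]
    simp
  · simp only [Prod.snd_sub, Prod.smul_snd, Prod.snd_sum]
    have h1 : ¬ Even (2 * K + 1) := by
      rw [Nat.even_iff]
      omega
    simp [h1]

/-- `m` is an odd prime or twice an odd prime. -/
def OddPrimeType (m p : ℕ) : Prop := p.Prime ∧ 3 ≤ p ∧ (m = p ∨ m = 2 * p)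

theorem OddPrimeType.odd {m p : ℕ} (h : OddPrimeType m p) : Odd p :=
  h.1.odd_of_ne_two (by have := h.2.1; omega)

theorem OddPrimeType.exists_eq {m p : ℕ} (h : OddPrimeType m p) : ∃ K, 0 < K ∧ p = 2 * K + 1 := by
  obtain ⟨K, hK⟩ := h.odd
  exact ⟨K, by have := h.2.1; omega, hK⟩

theorem ParityCondition.pow_two_or_oddPrimeType {k : ℕ} {n : Fin k → ℕ} (h : ParityCondition n)
    {i : Fin k} (hi : 2 ≤ n i) :
    (∃ e, 2 ≤ e ∧ n i + 1 = 2 ^ e) ∨ ∃ p, OddPrimeType (n i + 1) p := by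
  by_cases hp : ∃ p, p.Prime ∧ p ≠ 2 ∧ p ∣ n i + 1
  · obtain ⟨p, hp, hp2, s, hs⟩ := hp
    right
    have hp3 : 3 ≤ p := by
      have := hp.two_le
      omega
    refine ⟨p, hp, hp3, ?_⟩
    have h1 : ¬ 3 ≤ s := fun h3 => h.not_odd_prime_mul (hp.odd_of_ne_two hp2) hp.two_le h3 hs
    have h2 : s ≠ 0 := by
      rintro rfl
      simp at hs
    have h3 : s = 1 ∨ s = 2 := by omega
    rcases h3 with rfl | rfl
    · left; simpa using hs
    · right; rw [hs, mul_comm]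
  · push Not at hp
    left
    have h1 := Nat.eq_prime_pow_of_unique_prime_dvd (n := n i + 1) (p := 2) (by omega)
      (fun {d} hd hdvd => by
        by_contra hne
        exact hp d hd hne hdvd)
    refine ⟨_, ?_, h1⟩
    by_contra! hlt
    have : 2 ^ (n i + 1).primeFactorsList.length ≤ 2 ^ 1 :=
      Nat.pow_le_pow_right two_pos (by omega)
    omega

theorem ParityCondition.not_three_mod_four {k : ℕ} {n : Fin k → ℕ} (h : ParityCondition n)
    {i j : Fin k} (hij : i ≠ j) {p q : ℕ} (hi : OddPrimeType (n i + 1) p)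
    (hj : OddPrimeType (n j + 1) q) (hip : n i + 1 = p) : p % 4 = 1 := by
  obtain ⟨K, hK, rfl⟩ := hi.exists_eq
  obtain ⟨L, hL, rfl⟩ := hj.exists_eq
  have h1 := relation_mem_range_of_prime hip hK (c := 2) (t := K) rfl
  have h2 : ∃ e : ℤ, ((0 : ℤ), -((-2 : ℤ) : ℝ), e) ∈ (relationTriple (n j)).range := by
    rcases hj.2.2 with h2 | h2
    · exact ⟨-L, relation_mem_range_of_prime h2 hL (by ring)⟩
    · exact ⟨_, relation_mem_range_of_two_mul_prime h2 hL _⟩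
  obtain ⟨e, he⟩ := h2
  have h3 := h.even_of_mem_of_mem hij h1 (e' := e) (by simpa using he)
  rw [Int.even_coe_nat, Nat.even_iff] at h3
  omega

/-- Two odd factors exchange the value 1. For m = p = 2K + 1 this needs K even, obtained beforehand
by exchanging the value 2; the antisymmetric part is then K/2. For m = 2p it is K up to sign. -/
theorem ParityCondition.congruence {k : ℕ} {n : Fin k → ℕ} (h : ParityCondition n)
    {i j : Fin k} (hij : i ≠ j) {p q : ℕ} (hi : OddPrimeType (n i + 1) p)
    (hj : OddPrimeType (n j + 1) q) :
    (n i + 1 = p → p % 8 = 1) ∧ (n i + 1 = 2 * p → p % 4 = 1) := by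
  have h2 : ∃ e : ℤ, ((0 : ℤ), -((-1 : ℤ) : ℝ), e) ∈ (relationTriple (n j)).range := by
    rcases hj.2.2 with h2 | h2
    · have h3 := h.not_three_mod_four hij.symm hj hi h2
      obtain ⟨L, hL, rfl⟩ := hj.exists_eq
      exact ⟨-((L / 2 : ℕ) : ℤ), relation_mem_range_of_prime h2 hL (by omega)⟩
    · obtain ⟨L, hL, rfl⟩ := hj.exists_eq
      exact ⟨_, relation_mem_range_of_two_mul_prime h2 hL _⟩
  obtain ⟨e, he⟩ := h2
  have h4 := h.not_three_mod_four hij hi hj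
  obtain ⟨K, hK, rfl⟩ := hi.exists_eq
  constructor
  · intro hip
    have h5 := h4 hip
    have h6 := relation_mem_range_of_prime hip hK (c := 1) (t := ((K / 2 : ℕ) : ℤ)) (by omega)
    have h7 := h.even_of_mem_of_mem hij h6 (e' := e) (by simpa using he)
    rw [Int.even_coe_nat, Nat.even_iff] at h7
    omega
  · intro hip
    have h6 := relation_mem_range_of_two_mul_prime hip hK 1
    have h7 := h.even_of_mem_of_mem hij h6 (e' := e) (by simpa using he)
    rw [one_mul, even_neg, Int.even_coe_nat, Nat.even_iff] at h7
    omega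

/-! ### Galois conjugation and sufficiency -/

theorem exp_pow_add_exp_pow (M u e : ℕ) (hM : 0 < M) :
    (Complex.exp (2 * Real.pi * Complex.I / M) ^ u) ^ e +
      (Complex.exp (2 * Real.pi * Complex.I / M) ^ u) ^ ((M - 1) * e) =
      ((2 * Real.cos (2 * Real.pi * (u * e) / M) : ℝ) : ℂ) := by
  have hMC : (M : ℂ) ≠ 0 := by exact_mod_cast hM.ne'
  rw [← pow_mul, ← pow_mul, ← Complex.exp_nat_mul, ← Complex.exp_nat_mul, Complex.ofReal_mul,
    Complex.ofReal_cos, Complex.ofReal_ofNat, Complex.two_cos]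
  congr 1
  · congr 1
    push_cast
    ring
  · refine Eq.trans ?_ (Complex.exp_periodic.nat_mul (u * e) _)
    congr 1
    push_cast [Nat.cast_sub (show 1 ≤ M from hM)]
    field_simp
    ring

/-- Galois conjugation of an integral relation between cosines of rational angles. -/
theorem sum_cos_mul_coprime {α : Type*} (s : Finset α) (c : α → ℤ) (e : α → ℕ) {M u : ℕ}
    (hM : 0 < M) (hu : u.Coprime M)
    (h : ∑ a ∈ s, (c a : ℝ) * (2 * Real.cos (2 * Real.pi * e a / M)) = 0) :
    ∑ a ∈ s, (c a : ℝ) * (2 * Real.cos (2 * Real.pi * (u * e a) / M)) = 0 := by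
  set ζ := Complex.exp (2 * Real.pi * Complex.I / M)
  have hζ : IsPrimitiveRoot ζ M := Complex.isPrimitiveRoot_exp M hM.ne'
  -- The exponent (M - 1)e stands for -e, so that P is a genuine integer polynomial. It vanishes at
  -- ζ, hence at ζ^u, which has the same minimal polynomial.
  set P : Polynomial ℤ := ∑ a ∈ s, Polynomial.C (c a) *
    (Polynomial.X ^ e a + Polynomial.X ^ ((M - 1) * e a))
  have hP : ∀ v : ℕ, Polynomial.aeval (ζ ^ v) P =
      ((∑ a ∈ s, (c a : ℝ) * (2 * Real.cos (2 * Real.pi * (v * e a) / M)) : ℝ) : ℂ) := by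
    intro v
    rw [map_sum, Complex.ofReal_sum]
    refine Finset.sum_congr rfl fun a _ => ?_
    rw [Complex.ofReal_mul, ← exp_pow_add_exp_pow M v (e a) hM]
    simp [ζ]
  have h1 : Polynomial.aeval ζ P = 0 := by
    have := hP 1
    rw [pow_one] at this
    rw [this]
    simpa using congrArg (fun x : ℝ => (x : ℂ)) h
  have h2 : minpoly ℤ (ζ ^ u) ∣ P := by
    rw [← hζ.minpoly_eq_pow_coprime hu]
    exact minpoly.isIntegrallyClosed_dvd (hζ.isIntegral hM) h1
  have h3 : Polynomial.aeval (ζ ^ u) P = 0 := by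
    obtain ⟨Q, hQ⟩ := h2
    rw [hQ, map_mul, minpoly.aeval, zero_mul]
  rw [hP] at h3
  exact_mod_cast h3

theorem sum_eigenvalue_mul_coprime {k : ℕ} (n : Fin k → ℕ) (l : (i : Fin k) → Fin (n i) → ℤ)
    {u : ℕ} (hu : u.Coprime (2 * ∏ i, (n i + 1)))
    (h : ∑ i, ∑ r, (l i r : ℝ) * pathEigenvalue (n i) r = 0) :
    ∑ i, ∑ r, (l i r : ℝ) * (2 * Real.cos (Real.pi * (u * (r + 1)) / (n i + 1))) = 0 := by
  have hM : 0 < 2 * ∏ i, (n i + 1) :=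
    Nat.mul_pos two_pos (Finset.prod_pos fun i _ => Nat.succ_pos _)
  -- Numerators over the common denominator 2∏(n i + 1), the 2 turning multiples of π into multiples
  -- of 2π.
  set e : (Σ i : Fin k, Fin (n i)) → ℕ := fun a =>
    (a.2 + 1) * ∏ j ∈ Finset.univ.erase a.1, (n j + 1)
  have he : ∀ (v : ℝ) a, 2 * Real.pi * (v * e a) / (2 * ∏ i, (n i + 1) : ℕ) =
      Real.pi * (v * (a.2 + 1)) / (n a.1 + 1) := by
    intro v a
    rw [← Finset.mul_prod_erase _ _ (Finset.mem_univ a.1)]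
    have : ((∏ j ∈ Finset.univ.erase a.1, (n j + 1) : ℕ) : ℝ) ≠ 0 := by
      exact_mod_cast (Finset.prod_pos fun i _ => Nat.succ_pos _).ne'
    simp only [e]
    push_cast at this ⊢
    field_simp
  have := sum_cos_mul_coprime Finset.univ (fun a : Σ i : Fin k, Fin (n i) => l a.1 a.2) e hM hu (by
    rw [Fintype.sum_sigma, ← h]
    refine Finset.sum_congr rfl fun i _ => Finset.sum_congr rfl fun r _ => ?_
    have h1 := he 1 ⟨i, r⟩
    rw [one_mul, one_mul] at h1
    rw [h1]
    rfl)
  simp_rw [he] at this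
  rw [Fintype.sum_sigma] at this
  exact this

/-- If p ∤ x, the spacing πDx/m is not a multiple of 2π but p times it is, so the sum vanishes. If p
∣ x, then m = 2p and x = p, and every angle is π/2 modulo 2π. -/
theorem sum_cos_progression_eq_zero {m p D x : ℕ} (hp : OddPrimeType m p) (hD : 4 ∣ D)
    (hpD : ¬ p ∣ D) (hx0 : 0 < x) (hxm : x < m) :
    ∑ k ∈ Finset.range p, 2 * Real.cos (Real.pi * ((1 + D * k : ℕ) * x) / m) = 0 := by
  obtain ⟨C, rfl⟩ := hD
  have hp0 : (p : ℝ) ≠ 0 := by exact_mod_cast hp.1.ne_zero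
  have hm0 : (m : ℝ) ≠ 0 := by exact_mod_cast (by omega : m ≠ 0)
  have hpC : ¬ p ∣ C := fun h => hpD (h.mul_left 4)
  by_cases hpx : p ∣ x
  · obtain ⟨y, rfl⟩ := hpx
    have hm : m = 2 * p := by
      refine hp.2.2.resolve_left ?_
      rintro rfl
      have := Nat.le_of_dvd hx0 (Dvd.intro _ rfl)
      omega
    have hy : y = 1 := by
      have h1 : p * y < p * 2 := by omega
      have h2 := Nat.lt_of_mul_lt_mul_left h1
      have h3 : y ≠ 0 := by rintro rfl; simp at hx0
      omega
    subst hy hm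
    refine Finset.sum_eq_zero fun k _ => ?_
    rw [show Real.pi * ((1 + 4 * C * k : ℕ) * (p * 1 : ℕ)) / (2 * p : ℕ) =
      Real.pi / 2 + (C * k : ℕ) * (2 * Real.pi) by push_cast; field_simp; ring,
      Real.cos_add_nat_mul_two_pi, Real.cos_pi_div_two, mul_zero]
  · have h := sin_mul_sum_cos (Real.pi * x / m) (Real.pi * x * (2 * C) / m) p
    have hsin : Real.sin (Real.pi * x * (2 * C) / m) ≠ 0 := by
      intro h0
      obtain ⟨z, hz⟩ := Real.sin_eq_zero_iff.1 h0
      have h1 : (z : ℝ) * m = x * (2 * C) := by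
        field_simp at hz
        have := Real.pi_pos.ne'
        nlinarith
      have h2 : z * m = (x : ℤ) * (2 * C) := by exact_mod_cast h1
      have hpZ : Prime (p : ℤ) := Nat.prime_iff_prime_int.1 hp.1
      have h3 : (p : ℤ) ∣ (x : ℤ) * C := by
        rcases hp.2.2 with hm | hm
        · have h4 : (p : ℤ) ∣ 2 * ((x : ℤ) * C) := ⟨z, by rw [hm] at h2; linarith⟩
          refine (hpZ.dvd_or_dvd h4).resolve_left fun h5 => ?_
          have h6 : p ∣ 2 := by exact_mod_cast h5
          have := Nat.le_of_dvd two_pos h6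
          have := hp.2.1
          omega
        · refine ⟨z, ?_⟩
          rw [hm] at h2
          push_cast at h2
          linarith
      have h4 : p ∣ x * C := by exact_mod_cast h3
      exact (hp.1.dvd_mul.1 h4).elim hpx hpC
    have hper : Real.sin (Real.pi * x / m + (2 * p - 1) * (Real.pi * x * (2 * C) / m)) =
        Real.sin (Real.pi * x / m - Real.pi * x * (2 * C) / m) := by
      rcases hp.2.2 with hm | hm
      · rw [← Real.sin_add_nat_mul_two_pi (Real.pi * x / m - _) (x * (2 * C))]
        congr 1
        rw [hm]
        push_cast
        field_simp
        ring
      · rw [← Real.sin_add_nat_mul_two_pi (Real.pi * x / m - _) (x * C)]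
        congr 1
        rw [hm]
        push_cast
        field_simp
        ring
    rw [hper, sub_self] at h
    rw [← (mul_eq_zero.1 h).resolve_left hsin]
    refine Finset.sum_congr rfl fun k _ => ?_
    congr 2
    push_cast
    field_simp
    ring

/-- The value at `x` of the cosine with angle `π x w p / m`, where `w` is odd. -/
def cosineSign (m p x : ℕ) : ℤ :=
  if m = p then (-1) ^ x else if Even x then (-1) ^ (x / 2) else 0

theorem cos_eq_cosineSign {m p w : ℕ} (hp : OddPrimeType m p) (hw : Odd w) (x : ℕ) :
    Real.cos (Real.pi * ((p * w : ℕ) * x) / m) = cosineSign m p x := by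
  have hp0 : (p : ℝ) ≠ 0 := by exact_mod_cast hp.1.ne_zero
  unfold cosineSign
  split_ifs with hm hx
  · rw [hm, show Real.pi * ((p * w : ℕ) * x) / p = (w * x : ℕ) * Real.pi by
      push_cast; field_simp, Real.cos_nat_mul_pi, pow_mul, hw.neg_one_pow]
    push_cast
    rfl
  · obtain ⟨y, rfl⟩ := hx
    rw [hp.2.2.resolve_left hm, show Real.pi * ((p * w : ℕ) * (y + y : ℕ)) / (2 * p : ℕ) =
      (w * y : ℕ) * Real.pi by push_cast; field_simp; ring, Real.cos_nat_mul_pi, pow_mul,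
      hw.neg_one_pow, show (y + y) / 2 = y by omega]
    push_cast
    rfl
  · rw [Nat.not_even_iff_odd] at hx
    obtain ⟨y, hy⟩ := hw.mul hx
    rw [hp.2.2.resolve_left hm, show Real.pi * ((p * w : ℕ) * x) / (2 * p : ℕ) =
      Real.pi * (w * x : ℕ) / 2 by push_cast; field_simp, hy,
      Int.cast_zero, Real.cos_eq_zero_iff]
    exact ⟨y, by push_cast; ring⟩

theorem isIntegral_eigenvalue_sum (n : ℕ) (l : Fin n → ℤ) :
    IsIntegral ℤ (∑ r, (l r : ℝ) * pathEigenvalue n r) := by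
  refine IsIntegral.sum _ fun r _ => ?_
  refine (isIntegral_algebraMap (x := l r)).mul ?_
  have h : pathEigenvalue n r = 2 * Real.cos (((r + 1 : ℚ) / (n + 1) : ℚ) * Real.pi) := by
    rw [pathEigenvalue]
    congr 2
    push_cast
    ring
  rw [h]
  exact Real.isIntegral_two_mul_cos_rat_mul_pi _

theorem exists_int_eq_of_isIntegral {x : ℝ} (hx : IsIntegral ℤ x) {a b : ℤ} (ha : a ≠ 0)
    (h : (a : ℝ) * x = b) : ∃ c : ℤ, x = c := by
  have haR : (a : ℝ) ≠ 0 := by exact_mod_cast ha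
  refine hx.exists_int_iff_exists_rat.1 ⟨b / a, ?_⟩
  push_cast
  rw [eq_div_iff haR, mul_comm, h]

/-- Conjugation by u = 1 + Dt with p ∤ u fixes the eigenvalues of all other factors, hence also the
value of factor i, which is minus the rest. Summing over the p - 1 admissible t < p gives the left
side. The sum over all t < p is 0, so the left side is minus the term at the one excluded t. -/
theorem prime_sub_one_mul_eigenvalue_sum {k : ℕ} {n : Fin k → ℕ}
    {l : (i : Fin k) → Fin (n i) → ℤ}
    (h : ∑ i, ∑ r, (l i r : ℝ) * pathEigenvalue (n i) r = 0) {i : Fin k} {p : ℕ}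
    (hp : OddPrimeType (n i + 1) p) (hdvd : ∀ j, j ≠ i → ¬ p ∣ n j + 1) :
    (p - 1 : ℝ) * ∑ r, (l i r : ℝ) * pathEigenvalue (n i) r =
      -2 * (∑ r : Fin (n i), l i r * cosineSign (n i + 1) p (r + 1) : ℤ) := by
  set N := ∏ j ∈ Finset.univ.erase i, (n j + 1)
  -- Divisibility by N leaves the cosines of the other factors unchanged; the 4 makes the angles of
  -- factor i close up modulo 2π when n i + 1 = 2p, and keeps 1 + Dt odd.
  set D := 4 * N
  have hpN : ¬ p ∣ N := by
    intro hd
    obtain ⟨j, hj, hjd⟩ := (hp.1.prime.dvd_finsetProd_iff _).1 hd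
    exact hdvd j (Finset.ne_of_mem_erase hj) hjd
  have hp3 := hp.2.1
  have hpD : ¬ p ∣ D := by
    intro hd
    rcases hp.1.dvd_mul.1 hd with h4 | hN
    · have h5 : p ∣ 2 := hp.1.dvd_of_dvd_pow (show p ∣ 2 ^ 2 from h4)
      have := Nat.le_of_dvd two_pos h5
      omega
    · exact hpN hN
  have hconj : ∀ t : ℕ, ¬ p ∣ 1 + D * t →
      ∑ r : Fin (n i), (l i r : ℝ) *
        (2 * Real.cos (Real.pi * ((1 + D * t : ℕ) * (r + 1)) / (n i + 1))) =
      ∑ r, (l i r : ℝ) * pathEigenvalue (n i) r := by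
    intro t ht
    have hcop : (1 + D * t).Coprime (2 * ∏ i, (n i + 1)) := by
      have h2N : (1 + D * t).Coprime (2 * N) := by
        rw [show 1 + D * t = 1 + (2 * N) * (2 * t) by simp only [D]; ring]
        simp
      have hcp : (1 + D * t).Coprime p := ((Nat.Prime.coprime_iff_not_dvd hp.1).2 ht).symm
      rw [← Finset.mul_prod_erase _ _ (Finset.mem_univ i), mul_left_comm]
      refine Nat.Coprime.mul_right ?_ h2N
      rcases hp.2.2 with hm | hm
      · rwa [hm]
      · rw [hm]
        exact Nat.Coprime.mul_right (Nat.Coprime.coprime_dvd_right (Dvd.intro _ rfl) h2N) hcp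
    have h1 := sum_eigenvalue_mul_coprime n l hcop h
    rw [← Finset.add_sum_erase _ _ (Finset.mem_univ i)] at h1 h
    have h2 : ∀ j ∈ Finset.univ.erase i, ∑ r : Fin (n j), (l j r : ℝ) *
        (2 * Real.cos (Real.pi * ((1 + D * t : ℕ) * (r + 1)) / (n j + 1))) =
        ∑ r, (l j r : ℝ) * pathEigenvalue (n j) r := by
      intro j hj
      obtain ⟨c, hc⟩ : n j + 1 ∣ N := Finset.dvd_prod_of_mem (fun j => n j + 1) hj
      refine Finset.sum_congr rfl fun r _ => ?_
      rw [pathEigenvalue]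
      congr 2
      refine Eq.trans ?_ (Real.cos_add_nat_mul_two_pi _ (2 * c * t * (r + 1)))
      congr 1
      have : (N : ℝ) = (n j + 1) * c := by exact_mod_cast hc
      simp only [D]
      push_cast
      rw [this]
      field_simp
      ring
    rw [Finset.sum_congr rfl h2] at h1
    linarith
  obtain ⟨t₀, ht₀, hpt₀⟩ : ∃ t < p, p ∣ 1 + D * t := by
    have : Fact p.Prime := ⟨hp.1⟩
    have hD0 : (D : ZMod p) ≠ 0 := by rwa [Ne, ZMod.natCast_eq_zero_iff]
    refine ⟨(-(D : ZMod p)⁻¹).val, ZMod.val_lt _, ?_⟩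
    rw [← ZMod.natCast_eq_zero_iff]
    push_cast
    rw [ZMod.natCast_zmod_val, mul_neg, mul_inv_cancel₀ hD0, add_neg_cancel]
  have huniq : ∀ t ∈ (Finset.range p).erase t₀, ¬ p ∣ 1 + D * t := by
    intro t ht hd
    rw [Finset.mem_erase, Finset.mem_range] at ht
    have h1 : 1 + D * t ≡ 1 + D * t₀ [MOD p] :=
      ((Nat.modEq_zero_iff_dvd).2 hd).trans ((Nat.modEq_zero_iff_dvd).2 hpt₀).symm
    have h2 : t ≡ t₀ [MOD p] :=
      Nat.ModEq.cancel_left_of_coprime ((Nat.Prime.coprime_iff_not_dvd hp.1).2 hpD)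
        (Nat.ModEq.add_left_cancel' 1 h1)
    exact ht.1 (Nat.ModEq.eq_of_lt_of_lt h2 ht.2 ht₀)
  obtain ⟨w, hw⟩ := hpt₀
  have hwodd : Odd w := by
    have h1 : Odd (p * w) := by
      rw [← hw]
      exact ⟨2 * N * t₀, by simp only [D]; ring⟩
    exact (Nat.odd_mul.1 h1).2
  have hsum : ∑ t ∈ (Finset.range p).erase t₀, ∑ r : Fin (n i), (l i r : ℝ) *
        (2 * Real.cos (Real.pi * ((1 + D * t : ℕ) * (r + 1)) / (n i + 1))) =
      (p - 1 : ℝ) * ∑ r, (l i r : ℝ) * pathEigenvalue (n i) r := by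
    rw [Finset.sum_congr rfl fun t ht => hconj t (huniq t ht), Finset.sum_const,
      Finset.card_erase_of_mem (Finset.mem_range.2 ht₀), Finset.card_range, nsmul_eq_mul,
      Nat.cast_sub (by omega), Nat.cast_one]
  rw [← hsum, Finset.sum_comm]
  push_cast
  rw [Finset.mul_sum]
  refine Finset.sum_congr rfl fun r _ => ?_
  have h1 := sum_cos_progression_eq_zero (x := r + 1) hp (Dvd.intro _ rfl : 4 ∣ D) hpD (by omega)
    (by omega)
  rw [← Finset.add_sum_erase _ _ (Finset.mem_range.2 ht₀), hw, cos_eq_cosineSign hp hwodd] at h1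
  push_cast at h1 ⊢
  rw [← Finset.mul_sum]
  linear_combination (l i r : ℝ) * h1

/-- For a primitive 2^(e+1)-th root of unity ζ, ζ^(n+1) = -1, so each eigenvalue is ζ^(r+1) -
ζ^(n-r). The relation is then a polynomial of degree at most n vanishing at ζ, whose minimal
polynomial has degree 2^e = n + 1. All its coefficients vanish: the constant one is -c, and that of
X^(r+1) is l r - l r.rev. -/
theorem eigenvalue_relation_pow_two {n e : ℕ} (hn : n + 1 = 2 ^ e) (l : Fin n → ℤ) (c : ℤ)
    (h : ∑ r, (l r : ℝ) * pathEigenvalue n r = c) : c = 0 ∧ ∀ r, l r.rev = l r := by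
  have hM : 0 < 2 ^ (e + 1) := by positivity
  set ζ := Complex.exp (2 * Real.pi * Complex.I / (2 ^ (e + 1) : ℕ)) with hζdef
  have hζ : IsPrimitiveRoot ζ (2 ^ (e + 1)) := Complex.isPrimitiveRoot_exp _ hM.ne'
  set P : Polynomial ℤ := ∑ r : Fin n, Polynomial.C (l r) *
    (Polynomial.X ^ ((r : ℕ) + 1) - Polynomial.X ^ (n - r)) - Polynomial.C c with hPdef
  have hnC : (n : ℂ) + 1 ≠ 0 := by exact_mod_cast n.succ_ne_zero
  have hζ' : ζ = Complex.exp (Real.pi * Complex.I / (n + 1)) := by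
    have h1 : ((2 ^ (e + 1) : ℕ) : ℂ) = 2 * (n + 1) := by
      rw [pow_succ, ← hn]
      push_cast
      ring
    rw [hζdef, h1]
    congr 1
    field_simp
  have h0 : Polynomial.aeval ζ P = 0 := by
    have h1 : Polynomial.aeval ζ P =
        ((∑ r, (l r : ℝ) * pathEigenvalue n r - c : ℝ) : ℂ) := by
      rw [hPdef, map_sub, map_sum, Complex.ofReal_sub, Complex.ofReal_sum]
      congr 1
      · refine Finset.sum_congr rfl fun r _ => ?_
        have h2 : ζ ^ ((r : ℕ) + 1) - ζ ^ (n - r) = (pathEigenvalue n r : ℂ) := by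
          rw [hζ', ← Complex.exp_nat_mul, ← Complex.exp_nat_mul, pathEigenvalue,
            Complex.ofReal_mul, Complex.ofReal_cos, Complex.ofReal_ofNat, Complex.two_cos,
            sub_eq_add_neg, ← Complex.exp_add_pi_mul_I]
          congr 1
          · congr 1
            push_cast
            ring
          · refine Eq.trans ?_ (Complex.exp_periodic _)
            congr 1
            push_cast [Nat.cast_sub r.2.le]
            field_simp
            ring
        rw [Complex.ofReal_mul, ← h2]
        simp
      · simp
    rw [h1, h, sub_self, Complex.ofReal_zero]
  have hP : P = 0 := by
    have h1 : minpoly ℤ ζ ∣ P := minpoly.isIntegrallyClosed_dvd (hζ.isIntegral hM) h0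
    rw [← Polynomial.cyclotomic_eq_minpoly hζ hM] at h1
    by_contra hne
    have h2 := Polynomial.natDegree_le_of_dvd h1 hne
    rw [Polynomial.natDegree_cyclotomic, Nat.totient_prime_pow_succ Nat.prime_two] at h2
    have h3 : P.natDegree ≤ n := by
      refine (Polynomial.natDegree_sub_le _ _).trans (max_le ?_ (by simp))
      refine Polynomial.natDegree_sum_le_of_forall_le _ _ fun r _ => ?_
      refine (Polynomial.natDegree_C_mul_le _ _).trans ?_
      refine (Polynomial.natDegree_sub_le _ _).trans (max_le ?_ ?_)
      · rw [Polynomial.natDegree_X_pow]; omega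
      · rw [Polynomial.natDegree_X_pow]; omega
    omega
  have hcoeff : ∀ x, P.coeff x = ∑ r : Fin n, l r *
      ((if x = (r : ℕ) + 1 then 1 else 0) - if x = n - r then 1 else 0) -
        if x = 0 then c else 0 := by
    intro x
    simp only [hPdef, Polynomial.coeff_sub, Polynomial.finsetSum_coeff, Polynomial.coeff_C_mul,
      Polynomial.coeff_X_pow, Polynomial.coeff_C]
  constructor
  · have h1 := hcoeff 0
    rw [hP, Polynomial.coeff_zero, Finset.sum_eq_zero] at h1
    · simpa using h1.symm
    · intro r _
      rw [if_neg (by omega), if_neg (by omega), sub_zero, mul_zero]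
  · intro r
    have h1 := hcoeff (r + 1)
    rw [hP, Polynomial.coeff_zero, if_neg (by omega), sub_zero] at h1
    simp only [mul_sub, Finset.sum_sub_distrib] at h1
    rw [Finset.sum_eq_single r, Finset.sum_eq_single r.rev] at h1
    · rw [if_pos rfl, if_pos (by rw [Fin.val_rev]; omega)] at h1
      linarith
    · intro s _ hs
      rw [if_neg, mul_zero]
      intro h2
      apply hs
      rw [Fin.ext_iff, Fin.val_rev]
      omega
    · simp
    · intro s _ hs
      rw [if_neg, mul_zero]
      intro h2
      apply hs
      rw [Fin.ext_iff]
      omega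
    · simp

theorem even_sum_sub_of_rev {n : ℕ} (f : Fin n → ℤ) (hf : ∀ r, f r.rev = f r) (h : Fin n)
    (hh : n = 2 * (h : ℕ) + 1) : Even (∑ r, f r - f h) := by
  rw [← Finset.add_sum_erase _ _ (Finset.mem_univ h), add_sub_cancel_left,
    ← ZMod.intCast_eq_zero_iff_even]
  push_cast
  refine Finset.sum_involution (fun r _ => r.rev) ?_ ?_ ?_ ?_
  · intro r _
    rw [hf]
    exact CharTwo.add_self_eq_zero _
  · intro r hr _ hrev
    apply Finset.ne_of_mem_erase hr
    rw [Fin.ext_iff, Fin.val_rev] at hrev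
    rw [Fin.ext_iff]
    omega
  · intro r hr
    rw [Finset.mem_erase] at hr ⊢
    refine ⟨fun hrev => hr.1 ?_, Finset.mem_univ _⟩
    rw [Fin.ext_iff, Fin.val_rev] at hrev
    rw [Fin.ext_iff]
    omega
  · intro r _
    exact Fin.rev_rev r

/-- Since n is odd, reversal preserves the parity of the index and fixes only the middle one,
2^(e-1) - 1, which is odd because e ≥ 2. Thus the total sum 0 and the antisymmetric sum are both
congruent to the middle coefficient modulo 2. -/
theorem even_antisymmetric_sum_of_pow_two {n e : ℕ} (he : 2 ≤ e) (hn : n + 1 = 2 ^ e)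
    (l : Fin n → ℤ) (hl : ∀ r, l r.rev = l r) (h0 : ∑ r, l r = 0) :
    Even (∑ r : Fin n, if Odd (r : ℕ) then l r else 0) := by
  obtain ⟨f, rfl⟩ := Nat.exists_eq_add_of_le he
  have hf : 0 < 2 ^ f := by positivity
  rw [pow_add] at hn
  set h : Fin n := ⟨2 * 2 ^ f - 1, by omega⟩
  have hh : n = 2 * (h : ℕ) + 1 := by simp only [h]; omega
  have hodd : Odd (h : ℕ) := by
    rw [Nat.odd_iff]
    simp only [h]
    omega
  have h1 := even_sum_sub_of_rev l hl h hh
  have h2 := even_sum_sub_of_rev (fun r : Fin n => if Odd (r : ℕ) then l r else 0) (by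
    intro r
    have : Odd ((r.rev : Fin n) : ℕ) ↔ Odd (r : ℕ) := by
      rw [Fin.val_rev, Nat.odd_iff, Nat.odd_iff]
      omega
    simp only [this, hl]) h hh
  rw [if_pos hodd] at h2
  rw [h0, zero_sub, even_neg] at h1
  simpa using h2.add h1

/-- Adding the zero sum of the l r turns the signs (-1)^(r+1) into 2 for odd r and 0 for even r. -/
theorem sum_mul_cosineSign_prime {p n : ℕ} (hn : n + 1 = p) (l : Fin n → ℤ)
    (h0 : ∑ r, l r = 0) : ∑ r : Fin n, l r * cosineSign (n + 1) p (r + 1) =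
      2 * ∑ r : Fin n, if Odd (r : ℕ) then l r else 0 := by
  have h1 : ∑ r : Fin n, l r * cosineSign (n + 1) p (r + 1) =
      ∑ r : Fin n, (l r * cosineSign (n + 1) p (r + 1) + l r) := by
    rw [Finset.sum_add_distrib, h0, add_zero]
  rw [h1, Finset.mul_sum]
  refine Finset.sum_congr rfl fun r _ => ?_
  rw [cosineSign, if_pos hn]
  split_ifs with h
  · rw [(h.add_odd odd_one).neg_one_pow]
    ring
  · rw [Nat.not_odd_iff_even] at h
    rw [h.add_one.neg_one_pow]
    ring

/-- Here `cosineSign` is ±1 exactly at odd r and 0 elsewhere. -/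
theorem even_sum_mul_cosineSign_sub {p n : ℕ} (hn : n + 1 ≠ p) (l : Fin n → ℤ) :
    Even (∑ r : Fin n, l r * cosineSign (n + 1) p (r + 1) -
      ∑ r : Fin n, if Odd (r : ℕ) then l r else 0) := by
  rw [← Finset.sum_sub_distrib]
  refine Finset.even_sum _ fun r _ => ?_
  rw [cosineSign, if_neg hn]
  by_cases h : Odd (r : ℕ)
  · rw [if_pos (h.add_odd odd_one), if_pos h]
    rcases neg_one_pow_eq_or ℤ (((r : ℕ) + 1) / 2) with h1 | h1
    · rw [h1]; simp
    · rw [h1]; exact ⟨-l r, by ring⟩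
  · rw [if_neg (by rw [Nat.not_even_iff_odd]; exact (Nat.not_odd_iff_even.1 h).add_one), if_neg h]
    simp

/-! ### Equivalence of the parity and arithmetic conditions -/

/-- The arithmetic conditions on the lengths of the factors under which all corners of a product of
paths are equivalent. -/
def ArithmeticCondition {k : ℕ} (n : Fin k → ℕ) : Prop :=
  (∀ i, (∃ e, 2 ≤ e ∧ n i + 1 = 2 ^ e) ∨ ∃ p, OddPrimeType (n i + 1) p) ∧
  (∀ i j, i ≠ j → ¬ n i + 1 ∣ n j + 1) ∧
  (∀ i j p q, i ≠ j → OddPrimeType (n i + 1) p → OddPrimeType (n j + 1) q →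
    (n i + 1 = p → p % 8 = 1) ∧ (n i + 1 = 2 * p → p % 4 = 1))

theorem ArithmeticCondition.not_dvd_of_ne {k : ℕ} {n : Fin k → ℕ} (h : ArithmeticCondition n)
    {i j : Fin k} (hij : j ≠ i) {p : ℕ} (hp : OddPrimeType (n i + 1) p) : ¬ p ∣ n j + 1 := by
  intro hd
  rcases h.1 j with ⟨e, he, hj⟩ | ⟨q, hq⟩
  · rw [hj] at hd
    have := (Nat.prime_dvd_prime_iff_eq hp.1 Nat.prime_two).1 (hp.1.dvd_of_dvd_pow hd)
    have := hp.2.1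
    omega
  · have hpq : p = q := by
      rcases hq.2.2 with hj | hj
      · rw [hj] at hd
        exact (Nat.prime_dvd_prime_iff_eq hp.1 hq.1).1 hd
      · rw [hj] at hd
        refine (hp.1.dvd_mul.1 hd).elim (fun h2 => ?_) fun h2 =>
          (Nat.prime_dvd_prime_iff_eq hp.1 hq.1).1 h2
        have := Nat.le_of_dvd two_pos h2
        have := hp.2.1
        omega
    subst hpq
    have h1 := h.2.1 i j hij.symm
    have h2 := h.2.1 j i hij
    rcases hp.2.2 with hi | hi <;> rcases hq.2.2 with hj | hj <;> rw [hi, hj] at h1 h2 <;>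
      simp at h1 h2

/-- Odd factors contribute integers, so the power-of-two factor, unique by non-divisibility,
contributes an integer as well; that integer is 0 and its coefficients are palindromic. For an odd
factor with value c and antisymmetric part E, (p - 1)c is -4E if m = p, and -2S with S ≡ E mod 2 if
m = 2p. -/
theorem ArithmeticCondition.parityCondition {k : ℕ} {n : Fin k → ℕ} (h : ArithmeticCondition n) :
    ParityCondition n := by
  intro l hl0 hl
  set V : Fin k → ℝ := fun i => ∑ r, (l i r : ℝ) * pathEigenvalue (n i) r
  set S : ∀ i : Fin k, ℕ → ℤ := fun i p => ∑ r : Fin (n i), l i r * cosineSign (n i + 1) p (r + 1)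
  have hodd : ∀ i p, OddPrimeType (n i + 1) p → ∃ c : ℤ, V i = c ∧ ((p : ℤ) - 1) * c = -2 * S i p := by
    intro i p hp
    have h1 := prime_sub_one_mul_eigenvalue_sum hl hp fun j hj => h.not_dvd_of_ne hj hp
    have hp3 := hp.2.1
    obtain ⟨c, hc⟩ := exists_int_eq_of_isIntegral (isIntegral_eigenvalue_sum (n i) (l i))
      (a := (p : ℤ) - 1) (b := -2 * S i p) (by omega) (by simp only [S]; push_cast at h1 ⊢; exact h1)
    refine ⟨c, hc, ?_⟩
    rw [hc] at h1
    exact_mod_cast h1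
  have htwo_unique : ∀ i j e f, n i + 1 = 2 ^ e → n j + 1 = 2 ^ f → i = j := by
    intro i j e f hi hj
    by_contra hij
    rcases le_total e f with hef | hef
    · exact h.2.1 i j hij (by rw [hi, hj]; exact pow_dvd_pow 2 hef)
    · exact h.2.1 j i (Ne.symm hij) (by rw [hi, hj]; exact pow_dvd_pow 2 hef)
  have hsplit : ∀ i, V i = -∑ j ∈ Finset.univ.erase i, V j := by
    intro i
    have : V i + ∑ j ∈ Finset.univ.erase i, V j = 0 := by
      rw [Finset.add_sum_erase _ _ (Finset.mem_univ i)]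
      exact hl
    linarith
  have htwo : ∀ i e, n i + 1 = 2 ^ e → V i = 0 ∧ ∀ r, l i r.rev = l i r := by
    intro i e hi
    have h1 : ∀ j, j ≠ i → ∃ c : ℤ, V j = c := by
      intro j hj
      rcases h.1 j with ⟨f, _, hf⟩ | ⟨p, hp⟩
      · exact absurd (htwo_unique j i f e hf hi) hj
      · obtain ⟨c, hc, _⟩ := hodd j p hp
        exact ⟨c, hc⟩
    choose! c hc using h1
    have h2 : V i = ((-∑ j ∈ Finset.univ.erase i, c j : ℤ) : ℝ) := by
      rw [hsplit]
      push_cast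
      rw [Finset.sum_congr rfl fun j hj => hc j (Finset.ne_of_mem_erase hj)]
    obtain ⟨h3, h4⟩ := eigenvalue_relation_pow_two hi (l i) _ h2
    rw [h3] at h2
    exact ⟨by simpa using h2, h4⟩
  intro i
  rcases h.1 i with ⟨e, he, hi⟩ | ⟨p, hp⟩
  · exact even_antisymmetric_sum_of_pow_two he hi (l i) (htwo i e hi).2 (hl0 i)
  · obtain ⟨c, hc, hcS⟩ := hodd i p hp
    have hp3 := hp.2.1
    -- Either a second odd factor makes the congruences available, or every other factor is a power
    -- of two with value 0, so c = 0.
    have hkey : c = 0 ∨ (n i + 1 = p → p % 8 = 1) ∧ (n i + 1 = 2 * p → p % 4 = 1) := by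
      by_cases hex : ∃ j q, i ≠ j ∧ OddPrimeType (n j + 1) q
      · obtain ⟨j, q, hij, hq⟩ := hex
        exact Or.inr (h.2.2 i j p q hij hp hq)
      · left
        push Not at hex
        have h1 : V i = 0 := by
          rw [hsplit, Finset.sum_eq_zero, neg_zero]
          intro j hj
          rcases h.1 j with ⟨f, _, hf⟩ | ⟨q, hq⟩
          · exact (htwo j f hf).1
          · exact absurd hq (hex j q (Finset.ne_of_mem_erase hj).symm)
        rw [hc] at h1
        exact_mod_cast h1
    by_cases hm : n i + 1 = p
    · have h1 := sum_mul_cosineSign_prime hm (l i) (hl0 i)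
      change S i p = _ at h1
      rw [h1] at hcS
      set E := ∑ r : Fin (n i), if Odd (r : ℕ) then l i r else 0
      rcases hkey with h2 | h2
      · rw [h2] at hcS
        rw [Int.even_iff]
        omega
      · have h3 := h2.1 hm
        obtain ⟨a, ha⟩ : ∃ a : ℤ, (p : ℤ) - 1 = 8 * a := ⟨(p / 8 : ℕ), by omega⟩
        rw [ha] at hcS
        exact ⟨-(a * c), by linarith⟩
    · have h1 := even_sum_mul_cosineSign_sub hm (l i)
      change Even (S i p - _) at h1
      have hS : Even (S i p) := by
        rcases hkey with h2 | h2
        · rw [h2] at hcS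
          rw [Int.even_iff]
          omega
        · have h3 := h2.2 (hp.2.2.resolve_left hm)
          obtain ⟨a, ha⟩ : ∃ a : ℤ, (p : ℤ) - 1 = 4 * a := ⟨(p / 4 : ℕ), by omega⟩
          rw [ha] at hcS
          exact ⟨-(a * c), by linarith⟩
      simpa using hS.sub h1

theorem parityCondition_iff {k : ℕ} {n : Fin k → ℕ} (hn : ∀ i, 2 ≤ n i) :
    ParityCondition n ↔ ArithmeticCondition n :=
  ⟨fun h => ⟨fun i => h.pow_two_or_oddPrimeType (hn i), fun _ _ hij => h.not_dvd hij (hn _),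
    fun _ _ _ _ hij hp hq => h.congruence hij hp hq⟩, fun h => h.parityCondition⟩

/-! ### Translation into the four families -/

/-- `ArithmeticCondition` for the list of the lengths of the factors. -/
def ListCondition (L : List ℕ) : Prop :=
  L.Nodup ∧
  (∀ a ∈ L, (∃ e, 2 ≤ e ∧ a + 1 = 2 ^ e) ∨ ∃ p, OddPrimeType (a + 1) p) ∧
  (∀ a ∈ L, ∀ b ∈ L, a ≠ b → ¬ a + 1 ∣ b + 1) ∧
  (∀ a ∈ L, ∀ b ∈ L, ∀ p q, a ≠ b → OddPrimeType (a + 1) p → OddPrimeType (b + 1) q →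
    (a + 1 = p → p % 8 = 1) ∧ (a + 1 = 2 * p → p % 4 = 1))

/-- Equal lengths at distinct positions already violate non-divisibility, so distinct positions may
be replaced by distinct values in a duplicate-free list, a form invariant under permutation. -/
theorem arithmeticCondition_iff_listCondition {k : ℕ} (n : Fin k → ℕ) :
    ArithmeticCondition n ↔ ListCondition (List.ofFn n) := by
  simp only [ListCondition, List.nodup_ofFn, List.forall_mem_ofFn_iff]
  constructor
  · rintro ⟨h1, h2, h3⟩
    refine ⟨fun i j hij => ?_, h1, fun i j hij => h2 i j fun h => hij (by rw [h]),
      fun i j p q hij => h3 i j p q fun h => hij (by rw [h])⟩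
    by_contra hne
    exact h2 i j hne (by rw [hij])
  · rintro ⟨h0, h1, h2, h3⟩
    exact ⟨h1, fun i j hij => h2 i j (h0.ne hij), fun i j p q hij => h3 i j p q (h0.ne hij)⟩

theorem ListCondition.perm {L L' : List ℕ} (h : ListCondition L) (hp : L'.Perm L) :
    ListCondition L' := by
  simpa only [ListCondition, hp.nodup_iff, hp.mem_iff] using h

theorem ListCondition.of_cons {a : ℕ} {L : List ℕ} (h : ListCondition (a :: L)) :
    ListCondition L := by
  have hm : ∀ {b}, b ∈ L → b ∈ a :: L := fun hb => List.mem_cons_of_mem a hb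
  exact ⟨h.1.of_cons, fun b hb => h.2.1 b (hm hb), fun b hb c hc => h.2.2.1 b (hm hb) c (hm hc),
    fun b hb c hc => h.2.2.2 b (hm hb) c (hm hc)⟩

theorem OddPrimeType.not_pow_two {e p : ℕ} (h : OddPrimeType (2 ^ e) p) : False := by
  have hd : p ∣ 2 ^ e := by
    rcases h.2.2 with h1 | h1
    · rw [h1]
    · rw [h1]; exact Dvd.intro_left _ rfl
  have := (Nat.prime_dvd_prime_iff_eq h.1 Nat.prime_two).1 (h.1.dvd_of_dvd_pow hd)
  have := h.2.1
  omega

theorem OddPrimeType.dvd {m p : ℕ} (h : OddPrimeType m p) : p ∣ m := by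
  rcases h.2.2 with h1 | h1
  · rw [h1]
  · rw [h1]; exact Dvd.intro_left _ rfl

theorem OddPrimeType.eq_of_dvd {m p q : ℕ} (h : OddPrimeType m p) (hq : q.Prime) (hq3 : 3 ≤ q)
    (hd : q ∣ m) : q = p := by
  rcases h.2.2 with h1 | h1
  · rw [h1] at hd
    exact (Nat.prime_dvd_prime_iff_eq hq h.1).1 hd
  · rw [h1] at hd
    refine (hq.dvd_mul.1 hd).elim (fun h2 => ?_) fun h2 => (Nat.prime_dvd_prime_iff_eq hq h.1).1 h2
    have := Nat.le_of_dvd two_pos h2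
    omega

theorem OddPrimeType.not_pow_two_dvd {m p e : ℕ} (h : OddPrimeType m p) (he : 2 ≤ e) :
    ¬ 2 ^ e ∣ m := by
  intro hd
  have h4 : 4 ∣ m := (pow_dvd_pow 2 he).trans hd
  obtain ⟨K, hK⟩ := h.odd
  rcases h.2.2 with h1 | h1 <;> omega

theorem listCondition_pair {e a p : ℕ} (he : 2 ≤ e) (hp : OddPrimeType (a + 1) p) :
    ListCondition [2 ^ e - 1, a] := by
  have h2 : 2 ^ e - 1 + 1 = 2 ^ e := Nat.sub_add_cancel Nat.one_le_two_pow
  have hn1 : ¬ 2 ^ e - 1 + 1 ∣ a + 1 := by rw [h2]; exact hp.not_pow_two_dvd he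
  have hn2 : ¬ a + 1 ∣ 2 ^ e - 1 + 1 := fun hd => by
    have h3 := hp.dvd.trans hd
    rw [h2] at h3
    have := (Nat.prime_dvd_prime_iff_eq hp.1 Nat.prime_two).1 (hp.1.dvd_of_dvd_pow h3)
    have := hp.2.1
    omega
  have hne : 2 ^ e - 1 ≠ a := by
    intro h
    exact hn1 (by rw [h])
  have hno : ∀ q, ¬ OddPrimeType (2 ^ e - 1 + 1) q := fun q hq => by
    rw [h2] at hq
    exact hq.not_pow_two
  refine ⟨by simpa using hne, ?_, ?_, ?_⟩
  · intro b hb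
    simp only [List.mem_cons, List.not_mem_nil, or_false] at hb
    rcases hb with rfl | rfl
    · exact Or.inl ⟨e, he, h2⟩
    · exact Or.inr ⟨p, hp⟩
  · intro b hb c hc hbc
    simp only [List.mem_cons, List.not_mem_nil, or_false] at hb hc
    rcases hb with rfl | rfl <;> rcases hc with rfl | rfl
    · exact absurd rfl hbc
    · exact hn1
    · exact hn2
    · exact absurd rfl hbc
  · intro b hb c hc q q' hbc hq hq'
    simp only [List.mem_cons, List.not_mem_nil, or_false] at hb hc
    rcases hb with rfl | rfl
    · exact absurd hq (hno q)
    · rcases hc with rfl | rfl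
      · exact absurd hq' (hno q')
      · exact absurd rfl hbc

theorem listCondition_cons {e : ℕ} {P Q : List ℕ} (he : 2 ≤ e) (hnd : (P ++ Q).Nodup)
    (hP : ∀ p ∈ P, p.Prime ∧ p ≡ 1 [MOD 8]) (hQ : ∀ q ∈ Q, q.Prime ∧ q ≡ 1 [MOD 4]) :
    ListCondition
      ((2 ^ e - 1) :: (P.map (fun p => p - 1) ++ Q.map (fun q => 2 * q - 1))) := by
  have h2 : 2 ^ e - 1 + 1 = 2 ^ e := Nat.sub_add_cancel Nat.one_le_two_pow
  have hP' : ∀ p ∈ P, OddPrimeType (p - 1 + 1) p ∧ p % 8 = 1 ∧ p - 1 + 1 = p := by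
    intro p hp
    have h1 := (hP p hp).1.two_le
    have h3 : p % 8 = 1 := (hP p hp).2
    have h4 : p - 1 + 1 = p := by omega
    exact ⟨⟨(hP p hp).1, by omega, Or.inl h4⟩, h3, h4⟩
  have hQ' : ∀ q ∈ Q, OddPrimeType (2 * q - 1 + 1) q ∧ q % 4 = 1 ∧ 2 * q - 1 + 1 = 2 * q := by
    intro q hq
    have h1 := (hQ q hq).1.two_le
    have h3 : q % 4 = 1 := (hQ q hq).2
    have h4 : 2 * q - 1 + 1 = 2 * q := by omega
    exact ⟨⟨(hQ q hq).1, by omega, Or.inr h4⟩, h3, h4⟩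
  rw [List.nodup_append] at hnd
  set R := P.map (fun p => p - 1) ++ Q.map (fun q => 2 * q - 1) with hR
  have hRtype : ∀ a ∈ R, ∃ p, OddPrimeType (a + 1) p ∧
      ((p ∈ P ∧ a + 1 = p ∧ p % 8 = 1) ∨ (p ∈ Q ∧ a + 1 = 2 * p ∧ p % 4 = 1)) := by
    intro a ha
    rw [hR, List.mem_append, List.mem_map, List.mem_map] at ha
    rcases ha with ⟨p, hp, rfl⟩ | ⟨q, hq, rfl⟩
    · exact ⟨p, (hP' p hp).1, Or.inl ⟨hp, (hP' p hp).2.2, (hP' p hp).2.1⟩⟩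
    · exact ⟨q, (hQ' q hq).1, Or.inr ⟨hq, (hQ' q hq).2.2, (hQ' q hq).2.1⟩⟩
  -- Each entry is determined by its odd prime, because no prime occurs in both P and Q.
  have hRinj : ∀ a ∈ R, ∀ b ∈ R, ∀ p, OddPrimeType (a + 1) p → p ∣ b + 1 → a = b := by
    intro a ha b hb p hap hd
    obtain ⟨p', hp', ha'⟩ := hRtype a ha
    obtain ⟨q', hq', hb'⟩ := hRtype b hb
    have e1 : p = p' := hp'.eq_of_dvd hap.1 hap.2.1 hap.dvd
    have e2 : p = q' := hq'.eq_of_dvd hap.1 hap.2.1 hd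
    subst e1 e2
    rcases ha' with ha' | ha' <;> rcases hb' with hb' | hb'
    · omega
    · exact absurd rfl (hnd.2.2 p ha'.1 p hb'.1)
    · exact absurd rfl (hnd.2.2 p hb'.1 p ha'.1)
    · omega
  have hhead : ∀ a ∈ R, ¬ 2 ^ e - 1 + 1 ∣ a + 1 ∧ ¬ a + 1 ∣ 2 ^ e - 1 + 1 := by
    intro a ha
    obtain ⟨p, hp, _⟩ := hRtype a ha
    have h := listCondition_pair he hp
    have hne : 2 ^ e - 1 ≠ a := by simpa using h.1
    exact ⟨h.2.2.1 _ (by simp) _ (by simp) hne, h.2.2.1 _ (by simp) _ (by simp) hne.symm⟩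
  have hno : ∀ q, ¬ OddPrimeType (2 ^ e - 1 + 1) q := fun q hq => by
    rw [h2] at hq
    exact hq.not_pow_two
  refine ⟨?_, ?_, ?_, ?_⟩
  · rw [List.nodup_cons]
    refine ⟨fun h => (hhead _ h).1 dvd_rfl, ?_⟩
    rw [hR, List.nodup_append]
    refine ⟨List.Nodup.map_on ?_ hnd.1, List.Nodup.map_on ?_ hnd.2.1, ?_⟩
    · intro p hp q hq hpq
      have := (hP' p hp).2.2
      have := (hP' q hq).2.2
      omega
    · intro p hp q hq hpq
      have := (hQ' p hp).2.2
      have := (hQ' q hq).2.2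
      omega
    · intro a ha b hb
      rw [List.mem_map] at ha hb
      obtain ⟨p, hp, rfl⟩ := ha
      obtain ⟨q, hq, rfl⟩ := hb
      have := hP' p hp
      have := hQ' q hq
      omega
  · intro a ha
    rcases List.mem_cons.1 ha with rfl | ha
    · exact Or.inl ⟨e, he, h2⟩
    · obtain ⟨p, hp, _⟩ := hRtype a ha
      exact Or.inr ⟨p, hp⟩
  · intro a ha b hb hab hd
    rcases List.mem_cons.1 ha with rfl | ha <;> rcases List.mem_cons.1 hb with rfl | hb
    · exact hab rfl
    · exact (hhead b hb).1 hd
    · exact (hhead a ha).2 hd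
    · obtain ⟨p, hp, _⟩ := hRtype a ha
      exact hab (hRinj a ha b hb p hp (hp.dvd.trans hd))
  · intro a ha b hb p q hab hp hq
    rcases List.mem_cons.1 ha with rfl | ha
    · exact absurd hp (hno p)
    · obtain ⟨p', hp', ha'⟩ := hRtype a ha
      have e1 : p = p' := hp'.eq_of_dvd hp.1 hp.2.1 hp.dvd
      subst e1
      have := hp.2.1
      omega

/-- With at least two entries every entry has a partner of odd type, so its congruence holds.
Splitting by primality of a + 1 yields P and Q. -/
theorem exists_prime_lists {R : List ℕ} (h : ListCondition R)
    (hR : ∀ a ∈ R, ∃ p, OddPrimeType (a + 1) p) (hlen : 2 ≤ R.length) :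
    ∃ P Q : List ℕ, (P ++ Q).Nodup ∧
      (∀ p ∈ P, p.Prime ∧ p ≡ 1 [MOD 8]) ∧ (∀ q ∈ Q, q.Prime ∧ q ≡ 1 [MOD 4]) ∧
      R.Perm (P.map (fun p => p - 1) ++ Q.map (fun q => 2 * q - 1)) := by
  classical
  have hother : ∀ a ∈ R, ∃ b ∈ R, a ≠ b := by
    intro a ha
    by_contra! hall
    have h1 : R.length ≤ [a].length :=
      (h.1.subperm (fun b hb => by simp [← hall b hb])).length_le
    simp at h1
    omega
  have hcong : ∀ a ∈ R, ∀ p, OddPrimeType (a + 1) p →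
      (a + 1 = p → p % 8 = 1) ∧ (a + 1 = 2 * p → p % 4 = 1) := by
    intro a ha p hp
    obtain ⟨b, hb, hab⟩ := hother a ha
    obtain ⟨q, hq⟩ := hR b hb
    exact h.2.2.2 a ha b hb p q hab hp hq
  set R₁ := R.filter fun a => (a + 1).Prime
  set R₂ := R.filter fun a => !decide (a + 1).Prime
  have hperm : (R₁ ++ R₂).Perm R := List.filter_append_perm _ R
  have hR₁ : ∀ a ∈ R₁, a ∈ R ∧ (a + 1).Prime := fun a ha => by simpa [R₁] using ha
  have hR₂ : ∀ a ∈ R₂, a ∈ R ∧ OddPrimeType (a + 1) ((a + 1) / 2) ∧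
      a + 1 = 2 * ((a + 1) / 2) := by
    intro a ha
    have ha' : a ∈ R ∧ ¬ (a + 1).Prime := by simpa [R₂] using ha
    obtain ⟨p, hp⟩ := hR a ha'.1
    have h2 : a + 1 = 2 * p := hp.2.2.resolve_left fun h1 => ha'.2 (h1 ▸ hp.1)
    have h3 : (a + 1) / 2 = p := by omega
    rw [h3]
    exact ⟨ha'.1, hp, h2⟩
  refine ⟨R₁.map (fun a => a + 1), R₂.map (fun a => (a + 1) / 2), ?_, ?_, ?_, ?_⟩
  · rw [List.nodup_append]
    refine ⟨(h.1.filter _).map (fun a b hab => by simpa using hab),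
      (h.1.filter _).map_on ?_, ?_⟩
    · intro a ha b hb hab
      have h1 := (hR₂ a ha).2.2
      have h3 := (hR₂ b hb).2.2
      omega
    · intro p hp q hq hpq
      obtain ⟨a, ha, rfl⟩ := List.mem_map.1 hp
      obtain ⟨b, hb, rfl⟩ := List.mem_map.1 hq
      have h1 := (hR₂ b hb).2.2
      -- A prime p common to both lists would give entries with p ∣ 2p, against non-divisibility.
      refine h.2.2.1 a (hR₁ a ha).1 b (hR₂ b hb).1 ?_ ⟨2, by omega⟩
      rintro rfl
      omega
  · intro p hp
    obtain ⟨a, ha, rfl⟩ := List.mem_map.1 hp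
    obtain ⟨haR, hprime⟩ := hR₁ a ha
    refine ⟨hprime, ?_⟩
    obtain ⟨p, hp⟩ := hR a haR
    have e1 : a + 1 = p := hp.eq_of_dvd hprime (by
      have := hp.2.1
      rcases hp.2.2 with h1 | h1 <;> omega) dvd_rfl
    have := (hcong a haR p hp).1 e1
    rwa [← e1] at this
  · intro q hq
    obtain ⟨a, ha, rfl⟩ := List.mem_map.1 hq
    obtain ⟨haR, hop, h2⟩ := hR₂ a ha
    exact ⟨hop.1, (hcong a haR _ hop).2 h2⟩
  · refine hperm.symm.trans ?_
    rw [List.map_map, List.map_map]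
    refine List.Perm.of_eq ?_
    congr 1
    · refine (List.map_id'' (fun a => ?_) _).symm
      simp
    · refine (List.map_congr_left (g := id) fun a ha => ?_).trans (List.map_id _) |>.symm
      have := (hR₂ a ha).2.2
      simp only [Function.comp_apply, id]
      omega

/-- Of two powers of 2 one divides the other, so at most one occurs. The families correspond to the
remaining possibilities: no power of 2, or one power with a single odd entry (no congruence) or with
several. -/
theorem listCondition_iff {L : List ℕ} (hlen : 2 ≤ L.length) :
    ListCondition L ↔
      ((∃ e p : ℕ, 2 ≤ e ∧ p.Prime ∧ 3 ≤ p ∧ L.Perm [2 ^ e - 1, p - 1]) ∨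
       (∃ e p : ℕ, 2 ≤ e ∧ p.Prime ∧ 3 ≤ p ∧ L.Perm [2 ^ e - 1, 2 * p - 1]) ∨
       (∃ P Q : List ℕ, (P ++ Q).Nodup ∧
          (∀ p ∈ P, p.Prime ∧ p ≡ 1 [MOD 8]) ∧ (∀ q ∈ Q, q.Prime ∧ q ≡ 1 [MOD 4]) ∧
          L.Perm (P.map (fun p => p - 1) ++ Q.map (fun q => 2 * q - 1))) ∨
       (∃ (e : ℕ) (P Q : List ℕ), 2 ≤ e ∧ (P ++ Q).Nodup ∧
          (∀ p ∈ P, p.Prime ∧ p ≡ 1 [MOD 8]) ∧ (∀ q ∈ Q, q.Prime ∧ q ≡ 1 [MOD 4]) ∧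
          L.Perm ((2 ^ e - 1) :: (P.map (fun p => p - 1) ++ Q.map (fun q => 2 * q - 1))))) := by
  classical
  constructor
  · intro h
    set T := L.filter fun a => ∃ e, 2 ≤ e ∧ a + 1 = 2 ^ e
    set R := L.filter fun a => !decide (∃ e, 2 ≤ e ∧ a + 1 = 2 ^ e)
    have hperm : (T ++ R).Perm L := List.filter_append_perm _ L
    have hT : ∀ a ∈ T, a ∈ L ∧ ∃ e, 2 ≤ e ∧ a + 1 = 2 ^ e := fun a ha => by
      simpa [T] using ha
    have hR : ∀ a ∈ R, a ∈ L ∧ ∃ p, OddPrimeType (a + 1) p := by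
      intro a ha
      have ha' := List.mem_filter.1 ha
      refine ⟨ha'.1, (h.2.1 a ha'.1).resolve_left ?_⟩
      simpa using ha'.2
    have hTlen : T.length ≤ 1 := by
      rcases hTeq : T with _ | ⟨a, _ | ⟨b, T'⟩⟩
      · simp
      · simp
      · exfalso
        have hTn : T.Nodup := h.1.filter _
        have ha : a ∈ T := by simp [hTeq]
        have hb : b ∈ T := by simp [hTeq]
        have hab : a ≠ b := by
          rw [hTeq, List.nodup_cons] at hTn
          rintro rfl
          simp at hTn
        obtain ⟨haL, e, _, hae⟩ := hT a ha
        obtain ⟨hbL, f, _, hbf⟩ := hT b hb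
        rcases le_total e f with hef | hef
        · exact h.2.2.1 a haL b hbL hab (by rw [hae, hbf]; exact pow_dvd_pow 2 hef)
        · exact h.2.2.1 b hbL a haL hab.symm (by rw [hae, hbf]; exact pow_dvd_pow 2 hef)
    have hlen' := hperm.length_eq
    rw [List.length_append] at hlen'
    have hTR := h.perm hperm
    rcases hTeq : T with _ | ⟨t, _ | ⟨b, T'⟩⟩
    · rw [hTeq] at hperm hTR hlen'
      obtain ⟨P, Q, h1, h2, h3, h4⟩ := exists_prime_lists hTR (fun a ha => (hR a ha).2)
        (by simp at hlen' ⊢; omega)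
      exact Or.inr (Or.inr (Or.inl ⟨P, Q, h1, h2, h3, hperm.symm.trans h4⟩))
    · obtain ⟨e, he, hte⟩ := (hT t (by simp [hTeq])).2
      have ht : t = 2 ^ e - 1 := by omega
      rw [hTeq, ht] at hperm hTR
      rw [hTeq] at hlen'
      rcases hReq : R with _ | ⟨a, _ | ⟨b, R'⟩⟩
      · rw [hReq] at hlen'
        simp at hlen'
        omega
      · obtain ⟨p, hp⟩ := (hR a (by simp [hReq])).2
        rw [hReq] at hperm
        rcases hp.2.2 with h1 | h1
        · left
          refine ⟨e, p, he, hp.1, hp.2.1, ?_⟩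
          rw [← h1]
          exact hperm.symm
        · right; left
          refine ⟨e, p, he, hp.1, hp.2.1, ?_⟩
          rw [← h1]
          exact hperm.symm
      · obtain ⟨P, Q, h1, h2, h3, h4⟩ := exists_prime_lists (ListCondition.of_cons hTR)
          (fun a ha => (hR a ha).2) (by simp [hReq])
        exact Or.inr (Or.inr (Or.inr ⟨e, P, Q, he, h1, h2, h3, hperm.symm.trans (h4.cons _)⟩))
    · rw [hTeq] at hTlen
      simp at hTlen
  · rintro (⟨e, p, he, hp, hp3, hL⟩ | ⟨e, p, he, hp, hp3, hL⟩ | ⟨P, Q, h1, h2, h3, hL⟩ |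
      ⟨e, P, Q, he, h1, h2, h3, hL⟩)
    · exact (listCondition_pair he ⟨hp, hp3, Or.inl (by omega)⟩).perm hL
    · exact (listCondition_pair he ⟨hp, hp3, Or.inr (by omega)⟩).perm hL
    -- Case (3) is case (4) with e = 2 and the head removed, since the condition passes to sublists.
    · exact (ListCondition.of_cons (listCondition_cons le_rfl h1 h2 h3)).perm hL
    · exact (listCondition_cons he h1 h2 h3).perm hL

/-! ### The classification and large classes -/

theorem corners_class_iff {k : ℕ} {n : Fin k → ℕ} (hk : 2 ≤ k) (hn : ∀ i, 2 ≤ n i) :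
    (∃ C ∈ (pgstSetoid (pathProduct n)).classes, corners n ⊆ C) ↔
      ((∃ e p : ℕ, 2 ≤ e ∧ p.Prime ∧ 3 ≤ p ∧
          (List.ofFn n).Perm [2 ^ e - 1, p - 1]) ∨
       (∃ e p : ℕ, 2 ≤ e ∧ p.Prime ∧ 3 ≤ p ∧
          (List.ofFn n).Perm [2 ^ e - 1, 2 * p - 1]) ∨
       (∃ P Q : List ℕ, (P ++ Q).Nodup ∧
          (∀ p ∈ P, p.Prime ∧ p ≡ 1 [MOD 8]) ∧ (∀ q ∈ Q, q.Prime ∧ q ≡ 1 [MOD 4]) ∧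
          (List.ofFn n).Perm (P.map (fun p => p - 1) ++ Q.map (fun q => 2 * q - 1))) ∨
       (∃ (e : ℕ) (P Q : List ℕ), 2 ≤ e ∧ (P ++ Q).Nodup ∧
          (∀ p ∈ P, p.Prime ∧ p ≡ 1 [MOD 8]) ∧ (∀ q ∈ Q, q.Prime ∧ q ≡ 1 [MOD 4]) ∧
          (List.ofFn n).Perm
            ((2 ^ e - 1) :: (P.map (fun p => p - 1) ++ Q.map (fun q => 2 * q - 1))))) := by
  rw [exists_class_corners_subset_iff hn, parityCondition_iff hn,
    arithmeticCondition_iff_listCondition, listCondition_iff (by simpa using hk)]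

/-- The k corners reflected in a single coordinate already suffice for unbounded classes; the full
count 2^k is not needed. -/
theorem le_ncard_corners {k : ℕ} {n : Fin k → ℕ} (hn : ∀ i, 2 ≤ n i) : k ≤ (corners n).ncard := by
  set f : Fin k → (i : Fin k) → Fin (n i) := fun j i =>
    if i = j then ⟨n i - 1, by have := hn i; omega⟩ else ⟨0, by have := hn i; omega⟩
  have hf : Function.Injective f := by
    intro a b hab
    by_contra hne
    have h1 := congrArg (Fin.val) (congrFun hab a)
    simp only [f, if_true, if_neg hne] at h1
    have := hn a
    omega
  have h1 : Set.range f ⊆ corners n := by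
    rintro _ ⟨j, rfl⟩ i
    have := hn i
    by_cases hij : i = j
    · right
      simp only [f, if_pos hij]
      omega
    · left
      simp only [f, if_neg hij]
  have h2 := Set.ncard_le_ncard h1 (Set.toFinite _)
  rwa [← Set.image_univ, Set.ncard_image_of_injective _ hf, Set.ncard_univ, Nat.card_eq_fintype_card,
    Fintype.card_fin] at h2

theorem exists_large_class (N : ℕ) : ∃ (k : ℕ) (n : Fin k → ℕ), 2 ≤ k ∧ (∀ i, 2 ≤ n i) ∧
    ∃ C ∈ (pgstSetoid (pathProduct n)).classes, N ≤ C.ncard := by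
  have hinf : {p : ℕ | p.Prime ∧ p ≡ 1 [MOD 8]}.Infinite := by
    rw [Set.infinite_iff_exists_gt]
    intro a
    obtain ⟨p, hp, hap, h1⟩ := Nat.exists_prime_gt_modEq_one (k := 8) a (by norm_num)
    exact ⟨p, ⟨hp, h1⟩, hap⟩
  -- N + 2 primes congruent to 1 mod 8, used in family (3) with Q empty, give more than N corners
  -- and at least two factors.
  obtain ⟨s, hs, hcard⟩ := hinf.exists_subset_card_eq (N + 2)
  set P := s.toList
  have hP : ∀ p ∈ P, p.Prime ∧ p ≡ 1 [MOD 8] := fun p hp => hs (by simpa [P] using hp)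
  set L := P.map fun p => p - 1
  have hL : L.length = N + 2 := by simp [L, P, hcard]
  have hn : ∀ i, 2 ≤ L.get i := by
    intro i
    obtain ⟨p, hp, h1⟩ := List.mem_map.1 (L.get_mem i)
    have h2 := (hP p hp).1.two_le
    have h3 : p % 8 = 1 := (hP p hp).2
    omega
  have hk : 2 ≤ L.length := by omega
  obtain ⟨C, hC, hsub⟩ := (corners_class_iff hk hn).2 (Or.inr (Or.inr (Or.inl
    ⟨P, [], by simpa [P] using s.nodup_toList, hP, by simp, by
      rw [List.ofFn_get]
      simp [L]⟩)))
  refine ⟨L.length, L.get, hk, hn, C, hC, ?_⟩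
  have h1 := le_ncard_corners hn
  have h2 := Set.ncard_le_ncard hsub (Set.toFinite C)
  omega

theorem theorem1 :
    (∀ (k : ℕ) (n : Fin k → ℕ), 2 ≤ k → (∀ i, 2 ≤ n i) →
      ((∃ C ∈ (pgstSetoid (pathProduct n)).classes, corners n ⊆ C) ↔
        ((∃ e p : ℕ, 2 ≤ e ∧ p.Prime ∧ 3 ≤ p ∧
            (List.ofFn n).Perm [2 ^ e - 1, p - 1]) ∨
         (∃ e p : ℕ, 2 ≤ e ∧ p.Prime ∧ 3 ≤ p ∧
            (List.ofFn n).Perm [2 ^ e - 1, 2 * p - 1]) ∨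
         (∃ P Q : List ℕ, (P ++ Q).Nodup ∧
            (∀ p ∈ P, p.Prime ∧ p ≡ 1 [MOD 8]) ∧ (∀ q ∈ Q, q.Prime ∧ q ≡ 1 [MOD 4]) ∧
            (List.ofFn n).Perm (P.map (fun p => p - 1) ++ Q.map (fun q => 2 * q - 1))) ∨
         (∃ (e : ℕ) (P Q : List ℕ), 2 ≤ e ∧ (P ++ Q).Nodup ∧
            (∀ p ∈ P, p.Prime ∧ p ≡ 1 [MOD 8]) ∧ (∀ q ∈ Q, q.Prime ∧ q ≡ 1 [MOD 4]) ∧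
            (List.ofFn n).Perm
              ((2 ^ e - 1) :: (P.map (fun p => p - 1) ++ Q.map (fun q => 2 * q - 1))))))) ∧
    (∀ N : ℕ, ∃ (k : ℕ) (n : Fin k → ℕ), 2 ≤ k ∧ (∀ i, 2 ≤ n i) ∧
      ∃ C ∈ (pgstSetoid (pathProduct n)).classes, N ≤ C.ncard) :=
  ⟨fun _ _ hk hn => corners_class_iff hk hn, exists_large_class⟩
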